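/- **Conventions.** Let $K$ be a field and $\mathrm{vect}_K$ the category of finite dimensional $K$-vector spaces. Posets are regarded as categories. In a poset $J$, a *parent* of $a$ is an element $p<a$ with no $y$ such that $p<y<a$; $\mathcal P(a)$ is the set of parents of $a$. An *ancestor* of $S\subset J$ is an element $c\in J$ with $c\le s$ for all $s\in S$; a *sup* of $S$ is a minimal element of the set of upper bounds of $S$. $J$ is of *finite type* if $J\le a:=\{x\in J: x\le a\}$ is finite for every $a$. The *parental dimension* $\text{par-dim}_J(x)\in\mathbb N\cup\{\infty\}$ is the supremum of $|U|$ over the finite sets $U\subset\{y\in J: y<x\}$ which have an ancestor and for which $x$ is a sup of every two-element subset of $U$. **Realisation.** For a poset $I$, let $\mathcal R(I)$ be the set of pairs $(a,f)$ with $a\in I$ and $f\colon\mathcal P(a)\to(-1,0]$ such that $\mathrm{supp}(f)=\{p: f(p)<0\}$ is finite and has an ancestor in $I$. Put $(a,f)\le(b,g)$ if: $a\le b$; for every $x\in\mathcal P(b)$ with $g(x)<0$, either $a\le x$ or some parent of $a$ is $\le x$; and $\inf\{f(y): y\in\mathcal P(a),\ y\le x\}\le g(x)$ for every $x\in\mathcal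 P(b)$ such that $a\not\le x$ and some parent of $a$ is $\le x$. This is a partial order. For $d\in I$ and $V\subset(-1,0)$, let $\mathcal R_{I\le d}(I,V)\subset\mathcal R(I)$ be the subposet of those $(a,f)$ with $a\le d$ and all non-zero values of $f$ in $V$. **Betti diagrams.** A functor $J\to\mathrm{vect}_K$ is *free with Betti diagram* $W=\{W_a\}_{a\in J}$, where the $W_a$ are finite dimensional and only finitely many of them are non-zero, if it is a left Kan extension of $W$ along the identity function $(J,=)\to J$. For $n\in\mathbb N\cup\{\infty\}$, an *$n$-resolution* of $F\colon J\to\mathrm{vect}_K$ is an exact sequence $P_{n-1}\to\cdots\to P_0\to F\to0$ (infinite to the left if $n=\infty$) with all $P_i$ free; $F$ is *$n$-resolvable* if it has one. An $n$-resolution is *minimal* if every chain endomorphism of $P$ compatible with $P_0\to F$ is an isomorphism. If $P$ is a minimal $n$-resolution of $F$, then, for $i<n$, $\beta^iF$ denotes the Betti diagram of $P_i$, and $\mathrm{supp}(\beta^iF)=\{a:(\beta^iF)_a\neq0\}$. **Koszul complexes.** For a finite poset $J$, $G\colon J\to\mathrm{vect}_K$, $a\in J$ and a linear ordering $\prec$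 of $\mathcal P(a)$, the Koszul complex $\mathcal K_aG$ has $(\mathcal K_aG)_0=G(a)$ and, for $k>0$, $(\mathcal K_aG)_k=\bigoplus_S\mathrm{colim}_{\bigcap_{s\in S}(J\le s)}G$, the sum being over the $S\subset\mathcal P(a)$ with $|S|=k$ which have an ancestor in $J$. The differential in degree $1$ is induced by the maps $G(s<a)$, and in degree $k+1\ge2$ it is $\sum_{j=0}^k(-1)^j\partial_j$, where $\partial_j$ maps the summand of $S=\{s_0\prec\dots\prec s_k\}$ to that of $S\setminus\{s_j\}$ by the map of colimits induced by the inclusion of indexing posets. **Theorem.** Let $I$ be a poset of finite type, $n\in\mathbb N\cup\{\infty\}$, and $F\colon\mathcal R(I)\to\mathrm{vect}_K$ an $n$-resolvable functor. Then $F$ has a minimal $n$-resolution, so that $\beta^iF$ is defined for all $i<n$. Moreover, let $i<n$ be a natural number, $d\in I$, and let $V\subset(-1,0)$ be a finite set such that $\mathrm{supp}(\beta^jF)\subset\mathcal R_{I\le d}(I,V)$ for all $j\le i$. Let $\alpha\colon\mathcal R_{I\le d}(I,V)\hookrightarrow\mathcal R(I)$ be the inclusion of this finite poset. 1. If $i<3$,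 then $(\beta^iF)_{(a,f)}\cong H_i(\mathcal K_{(a,f)}(F\alpha))$ for every $(a,f)$ in $\mathcal R_{I\le d}(I,V)$. 2. If $(a,f)$ is in $\mathcal R_{I\le d}(I,V)$ and there is $\varepsilon\in V$ with $f(x)>\varepsilon$ for all $x\in\mathcal P(a)$, then $(\beta^iF)_{(a,f)}\cong H_i(\mathcal K_{(a,f)}(F\alpha))$. 3. If $(a,f)$ is in $\mathcal R(I)$ and $\text{par-dim}_{\mathcal R(I)}(a,f)<i$, then $(\beta^iF)_{(a,f)}=0$. In 1 and 2 the Koszul complex is formed with respect to an arbitrary linear ordering of the parents of $(a,f)$ in $\mathcal R_{I\le d}(I,V)$. -/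

import Mathlib

open CategoryTheory CategoryTheory.Limits

universe u v w

/-! ## Parents, finite type, parental dimension -/

/-- The set `𝒫(a)` of parents of an element `a` of a poset: the elements covered by `a`.
(A structure rather than a subtype, so that it carries no order of its own.) -/
@[ext]
structure Parent {J : Type v} [PartialOrder J] (a : J) where
  elt : J
  cov : elt ⋖ a

/-- A poset is of finite type if all its principal down-sets are finite. -/
def FiniteType (J : Type v) [PartialOrder J] : Prop :=
  ∀ a : J, (Set.Iic a).Finite

/-- `x` is a sup of `S`: a minimal element among the upper bounds (descendents) of `S`. -/
def IsSup {J : Type v} [PartialOrder J] (S : Set J) (x : J) : Prop :=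
  Minimal (fun y => y ∈ upperBounds S) x

/-- The collection `Ψ_J(x)` of the finite sets `U` of elements strictly below `x`, which have an
ancestor (a common lower bound in `J`), and such that `x` is a sup of every two-element subset. -/
def parDimSets {J : Type v} [PartialOrder J] (x : J) : Set (Finset J) :=
  {U | (∀ u ∈ U, u < x) ∧ (∃ c : J, ∀ u ∈ U, c ≤ u) ∧
    ∀ u ∈ U, ∀ u' ∈ U, u ≠ u' → IsSup {u, u'} x}

/-- The parental dimension of `x`. -/
noncomputable def parDim {J : Type v} [PartialOrder J] (x : J) : ℕ∞ :=
  ⨆ U ∈ parDimSets x, (U.card : ℕ∞)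

/-! ## The realisation of a poset -/

section Realisation

variable {I : Type v} [PartialOrder I]

/-- The set `𝒢(I)`: pairs `(a, f)` with `a` in `I` and `f : 𝒫(a) → [-1, 0]`. -/
structure GPoint (I : Type v) [PartialOrder I] where
  base : I
  val : Parent base → ℝ
  mem : ∀ p, val p ∈ Set.Icc (-1 : ℝ) 0

/-- `x` is `a`-dependent. -/
def IsDep (a x : I) : Prop := a ≤ x

/-- `x` is `a`-independent. -/
def IsIndep (a x : I) : Prop := ¬ a ≤ x ∧ ∃ p : Parent a, p.elt ≤ x

/-- `x` is `a`-consistent. -/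
def IsConsistent (a x : I) : Prop := IsDep a x ∨ IsIndep a x

namespace GPoint

/-- The relation on `𝒢(I)`. The infimum in `infi` is over a non-empty family, bounded below by
`-1`, hence it is the infimum in `[-1, 0]`. -/
structure Rel (A B : GPoint I) : Prop where
  base_le : A.base ≤ B.base
  consistent : ∀ x : Parent B.base, B.val x < 0 → IsConsistent A.base x.elt
  infi : ∀ x : Parent B.base, IsIndep A.base x.elt →
    ⨅ y : {y : Parent A.base // y.elt ≤ x.elt}, A.val y.1 ≤ B.val x

theorem bddBelow (A : GPoint I) (x : I) :
    BddBelow (Set.range fun y : {y : Parent A.base // y.elt ≤ x} => A.val y.1) := by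
  refine ⟨-1, ?_⟩
  rintro _ ⟨y, rfl⟩
  exact (A.mem y.1).1

theorem iInf_le_of_le (A : GPoint I) {x : I} (y : Parent A.base) (hy : y.elt ≤ x) :
    ⨅ y : {y : Parent A.base // y.elt ≤ x}, A.val y.1 ≤ A.val y :=
  ciInf_le (A.bddBelow x) ⟨y, hy⟩

theorem iInf_val_nonpos (A : GPoint I) (x : I) :
    ⨅ y : {y : Parent A.base // y.elt ≤ x}, A.val y.1 ≤ 0 :=
  Real.iInf_nonpos fun y => (A.mem y.1).2

theorem parent_not_le {a : I} (x : Parent a) : ¬ a ≤ x.elt := fun h =>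
  absurd x.cov.lt (not_lt_of_ge h)

theorem parent_eq {a : I} (x y : Parent a) (h : y.elt ≤ x.elt) : y = x := by
  rcases h.lt_or_eq with h | h
  · exact absurd x.cov.lt (y.cov.2 h)
  · exact Parent.ext h

theorem iInf_parent (A : GPoint I) (x : Parent A.base) :
    ⨅ y : {y : Parent A.base // y.elt ≤ x.elt}, A.val y.1 = A.val x := by
  apply le_antisymm (A.iInf_le_of_le x le_rfl)
  have : Nonempty {y : Parent A.base // y.elt ≤ x.elt} := ⟨⟨x, le_rfl⟩⟩
  refine le_ciInf fun y => ?_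
  rw [parent_eq x y.1 y.2]

theorem Rel.refl (A : GPoint I) : Rel A A where
  base_le := le_rfl
  consistent x _ := Or.inr ⟨parent_not_le x, x, le_rfl⟩
  infi x _ := (A.iInf_parent x).le

theorem Rel.trans {A B C : GPoint I} (h : Rel A B) (k : Rel B C) : Rel A C where
  base_le := h.base_le.trans k.base_le
  consistent x hx := by
    by_cases hax : A.base ≤ x.elt
    · exact Or.inl hax
    refine Or.inr ⟨hax, ?_⟩
    rcases k.consistent x hx with hb | hb
    · exact absurd (h.base_le.trans hb) hax
    have h1 := k.infi x hb
    obtain ⟨p, hp⟩ := hb.2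
    have : Nonempty {y : Parent B.base // y.elt ≤ x.elt} := ⟨⟨p, hp⟩⟩
    obtain ⟨y, hy⟩ := exists_lt_of_ciInf_lt (lt_of_le_of_lt h1 hx)
    rcases h.consistent y.1 hy with hd | hd
    · exact absurd (le_trans hd y.2) hax
    · obtain ⟨q, hq⟩ := hd.2
      exact ⟨q, hq.trans y.2⟩
  infi x hx := by
    rcases (C.mem x).2.lt_or_eq with hneg | h0
    · rcases k.consistent x hneg with hb | hb
      · exact absurd (h.base_le.trans hb) hx.1
      refine le_trans ?_ (k.infi x hb)
      obtain ⟨p, hp⟩ := hb.2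
      have : Nonempty {y : Parent B.base // y.elt ≤ x.elt} := ⟨⟨p, hp⟩⟩
      refine le_ciInf fun y => ?_
      rcases (B.mem y.1).2.lt_or_eq with hy | hy
      · rcases h.consistent y.1 hy with hd | hd
        · exact absurd (le_trans hd y.2) hx.1
        · refine le_trans ?_ (h.infi y.1 hd)
          obtain ⟨q, hq⟩ := hd.2
          have : Nonempty {z : Parent A.base // z.elt ≤ y.1.elt} := ⟨⟨q, hq⟩⟩
          exact le_ciInf fun z => A.iInf_le_of_le z.1 (z.2.trans y.2)
      · rw [hy]
        exact A.iInf_val_nonpos _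
    · rw [h0]
      exact A.iInf_val_nonpos _

theorem Rel.antisymm {A B : GPoint I} (h : Rel A B) (k : Rel B A) : A = B := by
  obtain ⟨a, f, hf⟩ := A
  obtain ⟨b, g, hg⟩ := B
  obtain rfl : a = b := le_antisymm h.base_le k.base_le
  congr
  funext x
  apply le_antisymm
  · have := h.infi x ⟨parent_not_le x, x, le_rfl⟩
    rwa [iInf_parent ⟨a, f, hf⟩ x] at this
  · have := k.infi x ⟨parent_not_le x, x, le_rfl⟩
    rwa [iInf_parent ⟨a, g, hg⟩ x] at this

instance : PartialOrder (GPoint I) where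
  le := Rel
  le_refl := Rel.refl
  le_trans _ _ _ := Rel.trans
  le_antisymm _ _ := Rel.antisymm

end GPoint

/-- The realisation `ℛ(I)`: the subposet of `𝒢(I)` of those `(a, f)` for which the values of `f`
are strictly bigger than `-1` and the support `{p | f p < 0}` is finite and has an ancestor
in `I`. -/
structure Realisation (I : Type v) [PartialOrder I] extends GPoint I where
  neg_one_lt : ∀ p, -1 < val p
  finite_support : {p | val p < 0}.Finite
  ancestor : ∃ c : I, ∀ p, val p < 0 → c ≤ p.elt

theorem Realisation.toGPoint_injective :
    Function.Injective (Realisation.toGPoint : Realisation I → GPoint I) := by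
  rintro ⟨x, _, _, _⟩ ⟨y, _, _, _⟩ h
  obtain rfl : x = y := h
  rfl

instance : PartialOrder (Realisation I) :=
  PartialOrder.lift Realisation.toGPoint Realisation.toGPoint_injective

/-- The grid `ℛ_D(I, V)` as a subset of `ℛ(I)`: those `(a, f)` with `a ∈ D` and with all the
non-zero values of `f` in `V`. -/
def grid (D : Set I) (V : Set ℝ) : Set (Realisation I) :=
  {x | x.base ∈ D ∧ ∀ p, x.val p < 0 → x.val p ∈ V}

/-- If `I` is of finite type and `V` is finite, then the grid `ℛ_{I ≤ d}(I, V)` is finite. -/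
theorem grid_finite (hI : FiniteType I) (d : I) {V : Set ℝ} (hV : V.Finite) :
    Finite (grid (Set.Iic d) V) := by
  have : Finite (Set.Iic d) := hI d
  have : Finite (insert (0 : ℝ) V : Set ℝ) := hV.insert 0
  have : ∀ a : I, Finite (Parent a) := fun a => by
    have : Finite (Set.Iic a) := hI a
    refine Finite.of_injective (fun p : Parent a => (⟨p.elt, p.cov.le⟩ : Set.Iic a)) ?_
    intro p q h
    exact Parent.ext (congrArg (fun z : Set.Iic a => z.1) h)
  let g : grid (Set.Iic d) V → Σ a : Set.Iic d, (Parent a.1 → (insert (0 : ℝ) V : Set ℝ)) :=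
    fun x => ⟨⟨x.1.base, x.2.1⟩, fun p => ⟨x.1.val p, by
      rcases (x.1.mem p).2.lt_or_eq with h | h
      · exact Or.inr (x.2.2 p h)
      · exact Or.inl h⟩⟩
  refine Finite.of_injective g ?_
  rintro ⟨⟨⟨a, f, hf⟩, _, _, _⟩, hx⟩ ⟨⟨⟨b, k, hk⟩, _, _, _⟩, hy⟩ h
  obtain ⟨h1, h2⟩ := Sigma.mk.inj_iff.1 h
  obtain rfl : a = b := congrArg Subtype.val h1
  have h3 := eq_of_heq h2
  obtain rfl : f = k := by
    funext p
    exact congrArg (fun z => (z p).1) h3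
  rfl

end Realisation

/-! ## Free functors, resolutions, Betti diagrams -/

section Resolutions

variable {K : Type u} [Field K] {J : Type v} [PartialOrder J]

/-- The support of a family of vector spaces. -/
def supp (W : J → ModuleCat.{w} K) : Set J := {a | Nontrivial (W a)}

/-- The functor `P` is free (finitely generated), with Betti diagram `W`: the family `W` consists
of finite dimensional spaces, has finite support, and `P` is a left Kan extension of `W` along
`(J, =) → J`. -/
def HasBettiDiagram (P : J ⥤ ModuleCat.{w} K) (W : J → ModuleCat.{w} K) : Prop :=
  (∀ a, Module.Finite K (W a)) ∧ (supp W).Finite ∧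
    ∃ η : Discrete.functor W ⟶ Discrete.functor (fun a : J => a) ⋙ P, P.IsLeftKanExtension η

/-- `P` is free (finitely generated). -/
def IsFree (P : J ⥤ ModuleCat.{w} K) : Prop :=
  ∃ W : J → ModuleCat.{w} K, HasBettiDiagram P W

/-- An `n`-resolution `P_{n-1} → ⋯ → P_0 → F → 0` of `F`, for an extended natural number `n`:
an exact sequence with all the `P_i` free. It is recorded as a chain complex which is zero in
degrees `≥ n`; there is no exactness condition at `P_{n-1}`. -/
structure Resolution (n : ℕ∞) (F : J ⥤ ModuleCat.{w} K) where
  complex : ChainComplex (J ⥤ ModuleCat.{w} K) ℕ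
  aug : complex.X 0 ⟶ F
  d_aug : complex.d 1 0 ≫ aug = 0
  free : ∀ i : ℕ, (i : ℕ∞) < n → IsFree (complex.X i)
  isZero : ∀ i : ℕ, n ≤ (i : ℕ∞) → IsZero (complex.X i)
  epi : 0 < n → Epi aug
  exact_zero : 1 < n → (ShortComplex.mk (complex.d 1 0) aug d_aug).Exact
  exact_succ : ∀ i : ℕ, ((i + 2 : ℕ) : ℕ∞) < n → complex.ExactAt (i + 1)

/-- `F` is `n`-resolvable. -/
def IsResolvable (n : ℕ∞) (F : J ⥤ ModuleCat.{w} K) : Prop :=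
  Nonempty (Resolution n F)

/-- An `n`-resolution is minimal if each of its chain endomorphisms over `F` is an isomorphism. -/
def Resolution.IsMinimal {n : ℕ∞} {F : J ⥤ ModuleCat.{w} K} (P : Resolution n F) : Prop :=
  ∀ φ : P.complex ⟶ P.complex, φ.f 0 ≫ P.aug = P.aug → IsIso φ

/-- `β i`, for `i < n`, are the Betti diagrams `β^i F` of `F`: there is a minimal `n`-resolution
`P` of `F` such that `β i` is the Betti diagram of the free functor `P_i` for every `i < n`. -/
def AreBettiDiagrams (n : ℕ∞) (F : J ⥤ ModuleCat.{w} K)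
    (β : ℕ → J → ModuleCat.{w} K) : Prop :=
  ∃ P : Resolution n F, P.IsMinimal ∧
    ∀ i : ℕ, (i : ℕ∞) < n → HasBettiDiagram (P.complex.X i) (β i)

end Resolutions

/-! ## Koszul complexes -/

section Koszul

variable {K : Type u} [Field K] {J : Type v} [PartialOrder J]

instance hasColimitsOfShape_of_finite_poset (D : Type v) [PartialOrder D] [Finite D] :
    HasColimitsOfShape D (ModuleCat.{w} K) := by
  have := Fintype.ofFinite D
  infer_instance

/-- The subposet `⋂_{s ∈ S} (J ≤ s)` of `J`, for a set `S` of parents of `a`. -/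
abbrev Below {a : J} (S : Finset (Parent a)) : Type v :=
  {x : J // ∀ s ∈ S, x ≤ s.elt}

instance {a : J} [Finite J] : Finite (Parent a) :=
  Finite.of_injective Parent.elt fun _ _ => Parent.ext

/-- The inclusion `⋂_{s ∈ S} (J ≤ s) ⊆ J` as a functor. -/
def belowIncl {a : J} (S : Finset (Parent a)) : Below S ⥤ J :=
  Monotone.functor (f := fun x : Below S => x.1) fun _ _ h => h

/-- The inclusion `⋂_{s ∈ S} (J ≤ s) ⊆ ⋂_{s ∈ T} (J ≤ s)`, for `T ⊆ S`, as a functor. -/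
def belowMono {a : J} {S T : Finset (Parent a)} (h : T ⊆ S) : Below S ⥤ Below T :=
  Monotone.functor (f := fun x : Below S => (⟨x.1, fun s hs => x.2 s (h hs)⟩ : Below T))
    fun _ _ h => h

theorem Below.le {a : J} {S : Finset (Parent a)} (hS : S.Nonempty) (x : Below S) : x.1 ≤ a := by
  obtain ⟨s, hs⟩ := hS
  exact (x.2 s hs).trans s.cov.le

/-- The sets of `k` parents of `a` which have an ancestor in `J`. -/
abbrev KoszulIdx (a : J) (k : ℕ) : Type v :=
  {S : Finset (Parent a) // S.card = k ∧ ∃ x : J, ∀ s ∈ S, x ≤ s.elt}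

theorem KoszulIdx.nonempty {a : J} {k : ℕ} (S : KoszulIdx a (k + 1)) : S.1.Nonempty :=
  Finset.card_pos.1 (by rw [S.2.1]; exact k.succ_pos)

/-- The index `S \ {s}`. -/
abbrev KoszulIdx.erase {a : J} [DecidableEq (Parent a)] {k : ℕ} (S : KoszulIdx a (k + 1))
    (s : Parent a) (hs : s ∈ S.1) : KoszulIdx a k :=
  ⟨S.1.erase s, by rw [Finset.card_erase_of_mem hs, S.2.1]; rfl,
    S.2.2.imp fun _ hx t ht => hx t (Finset.mem_of_mem_erase ht)⟩

/-- The sign `(-1)^j`, where `s = s_j` in `S = {s_0 ≺ ⋯ ≺ s_k}`. -/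
def koszulSign {a : J} [LinearOrder (Parent a)] (S : Finset (Parent a)) (s : Parent a) : ℤ :=
  (-1) ^ (S.filter (· < s)).card

theorem koszulSign_swap {a : J} [LinearOrder (Parent a)] {S : Finset (Parent a)} {s t : Parent a}
    (hs : s ∈ S) (ht : t ∈ S) (hst : s ≠ t) : koszulSign S s * koszulSign (S.erase s) t =
      -(koszulSign S t * koszulSign (S.erase t) s) := by
  wlog h : s < t generalizing s t
  · rw [this ht hs hst.symm (lt_of_le_of_ne (not_lt.1 h) hst.symm), neg_neg]
  have h1 : (S.erase t).filter (· < s) = S.filter (· < s) := by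
    rw [Finset.filter_erase, Finset.erase_eq_of_notMem]
    simp [h.le]
  have h2 : (S.filter (· < t)).card = ((S.erase s).filter (· < t)).card + 1 := by
    rw [Finset.filter_erase, Finset.card_erase_add_one]
    simp [hs, h]
  rw [koszulSign, koszulSign, koszulSign, koszulSign, h1, h2, pow_succ]
  ring

variable [Finite J] (G : J ⥤ ModuleCat.{w} K)

section

variable {a : J}

/-- `colim_{⋂_{s ∈ S} (J ≤ s)} G`. -/
noncomputable def belowColim (S : Finset (Parent a)) : ModuleCat.{w} K :=
  colimit (belowIncl S ⋙ G)

/-- The map `colim_{⋂_{s ∈ S} (J ≤ s)} G → colim_{⋂_{s ∈ T} (J ≤ s)} G` induced by the inclusion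
of posets, for `T ⊆ S`. -/
noncomputable def belowColimMap {S T : Finset (Parent a)} (h : T ⊆ S) :
    belowColim G S ⟶ belowColim G T :=
  colimit.pre (belowIncl T ⋙ G) (belowMono h)

/-- The map `colim_{⋂_{s ∈ S} (J ≤ s)} G → G(a)` induced by the maps `G(x ≤ a)`, for non-empty `S`.
If `S = {s}`, then the colimit is `G(s)`, since `s` is the greatest element of `J ≤ s`, and this
map is `G(s < a)`. -/
noncomputable def belowColimDesc {S : Finset (Parent a)} (hS : S.Nonempty) :
    belowColim G S ⟶ G.obj a :=
  colimit.desc (belowIncl S ⋙ G)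
    { pt := G.obj a
      ι :=
        { app := fun x => G.map (homOfLE (Below.le hS x))
          naturality := fun x y f => by
            dsimp
            rw [Category.comp_id, ← G.map_comp]
            rfl } }


/-- The canonical map `G(x) → colim_{⋂_{s ∈ S} (J ≤ s)} G`. -/
noncomputable def belowColimι {S : Finset (Parent a)} (x : Below S) :
    G.obj x.1 ⟶ belowColim G S :=
  colimit.ι (belowIncl S ⋙ G) x

theorem belowColim_hom_ext {S : Finset (Parent a)} {M : ModuleCat.{w} K}
    {f g : belowColim G S ⟶ M} (h : ∀ x, belowColimι G x ≫ f = belowColimι G x ≫ g) : f = g :=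
  colimit.hom_ext h

theorem belowColimι_map {S T : Finset (Parent a)} (h : T ⊆ S) (x : Below S) :
    belowColimι G x ≫ belowColimMap G h =
      belowColimι G (⟨x.1, fun s hs => x.2 s (h hs)⟩ : Below T) :=
  colimit.ι_pre (belowIncl T ⋙ G) (belowMono h) x

theorem belowColimι_desc {S : Finset (Parent a)} (hS : S.Nonempty) (x : Below S) :
    belowColimι G x ≫ belowColimDesc G hS = G.map (homOfLE (Below.le hS x)) :=
  colimit.ι_desc _ x

theorem belowColimMap_comp {S T R : Finset (Parent a)} (h : T ⊆ S) (k : R ⊆ T) :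
    belowColimMap G h ≫ belowColimMap G k = belowColimMap G (k.trans h) := by
  apply belowColim_hom_ext
  intro x
  rw [← Category.assoc, belowColimι_map, belowColimι_map, belowColimι_map]

theorem belowColimMap_desc {S T : Finset (Parent a)} (h : T ⊆ S) (hT : T.Nonempty) :
    belowColimMap G h ≫ belowColimDesc G hT = belowColimDesc G (hT.mono h) := by
  apply belowColim_hom_ext
  intro x
  rw [← Category.assoc, belowColimι_map, belowColimι_desc, belowColimι_desc]

end

variable (a : J)

/-- The direct sum of the colimits `colim_{⋂_{s ∈ S} (J ≤ s)} G` over the sets `S` of `k` parents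
of `a` which have an ancestor. -/
noncomputable def koszulSum (k : ℕ) : ModuleCat.{w} K :=
  ⨁ fun S : KoszulIdx a k => belowColim G S.1

variable {a} in
/-- The inclusion of the summand indexed by `S`. -/
noncomputable def koszulSumι {k : ℕ} (S : KoszulIdx a k) : belowColim G S.1 ⟶ koszulSum G a k :=
  biproduct.ι (fun S : KoszulIdx a k => belowColim G S.1) S

/-- The map out of the direct sum with the given components. -/
noncomputable def koszulSumDesc {k : ℕ} {M : ModuleCat.{w} K}
    (f : ∀ S : KoszulIdx a k, belowColim G S.1 ⟶ M) : koszulSum G a k ⟶ M :=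
  biproduct.desc f

theorem koszulSumι_desc {k : ℕ} {M : ModuleCat.{w} K}
    (f : ∀ S : KoszulIdx a k, belowColim G S.1 ⟶ M) (S : KoszulIdx a k) :
    koszulSumι G S ≫ koszulSumDesc G a f = f S :=
  biproduct.ι_desc f S

theorem koszulSum_hom_ext {k : ℕ} {M : ModuleCat.{w} K} {f g : koszulSum G a k ⟶ M}
    (h : ∀ S, koszulSumι G S ≫ f = koszulSumι G S ≫ g) : f = g :=
  biproduct.hom_ext' f g h

theorem belowColimMap_koszulSumι_congr {k : ℕ} {S : Finset (Parent a)} {T T' : KoszulIdx a k}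
    (e : T = T') (h : T.1 ⊆ S) (h' : T'.1 ⊆ S) :
    belowColimMap G h ≫ koszulSumι G T = belowColimMap G h' ≫ koszulSumι G T' := by
  subst e
  rfl

/-- The differential `(𝒦_a G)_1 → (𝒦_a G)_0 = G(a)`. -/
noncomputable def koszulDZero : koszulSum G a 1 ⟶ G.obj a :=
  koszulSumDesc G a fun S => belowColimDesc G S.nonempty

variable [LinearOrder (Parent a)]

/-- The differential `(𝒦_a G)_{k+1} → (𝒦_a G)_k` for `k > 0`. -/
noncomputable def koszulDSucc (k : ℕ) : koszulSum G a (k + 1) ⟶ koszulSum G a k :=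
  koszulSumDesc G a fun S => ∑ s : {s // s ∈ S.1}, koszulSign S.1 s.1 •
    (belowColimMap G (Finset.erase_subset s.1 S.1) ≫ koszulSumι G (S.erase s.1 s.2))

theorem koszulDSucc_comp_zero : koszulDSucc G a 1 ≫ koszulDZero G a = 0 := by
  apply koszulSum_hom_ext
  intro S
  rw [koszulDSucc, koszulDZero, ← Category.assoc, koszulSumι_desc, Preadditive.sum_comp, comp_zero]
  have key : ∀ s : {s // s ∈ S.1}, (koszulSign S.1 s.1 •
      (belowColimMap G (Finset.erase_subset s.1 S.1) ≫ koszulSumι G (S.erase s.1 s.2))) ≫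
        (koszulSumDesc G a fun S => belowColimDesc G S.nonempty) =
          koszulSign S.1 s.1 • belowColimDesc G S.nonempty := fun s => by
    rw [Preadditive.zsmul_comp, Category.assoc, koszulSumι_desc]
    congr 1
    exact belowColimMap_desc G _ _
  simp only [key]
  rw [← Finset.sum_smul, Finset.sum_coe_sort S.1 (koszulSign S.1)]
  obtain ⟨x, y, hxy, hS⟩ := Finset.card_eq_two.1 S.2.1
  have h := koszulSign_swap (S := S.1) (s := x) (t := y) (by simp [hS]) (by simp [hS]) hxy
  have e1 : koszulSign (S.1.erase x) y = 1 := by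
    have : (S.1.erase x).filter (· < y) = ∅ := by
      ext z
      simp only [hS, Finset.mem_filter, Finset.mem_erase, Finset.mem_insert, Finset.mem_singleton]
      grind
    rw [koszulSign, this]
    rfl
  have e2 : koszulSign (S.1.erase y) x = 1 := by
    have : (S.1.erase y).filter (· < x) = ∅ := by
      ext z
      simp only [hS, Finset.mem_filter, Finset.mem_erase, Finset.mem_insert, Finset.mem_singleton]
      grind
    rw [koszulSign, this]
    rfl
  rw [e1, e2, mul_one, mul_one] at h
  have : ∑ s ∈ S.1, koszulSign S.1 s = koszulSign S.1 x + koszulSign S.1 y := by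
    have := Finset.sum_pair (f := koszulSign S.1) hxy
    rwa [← hS] at this
  rw [this, h, neg_add_cancel, zero_smul]

theorem koszulDSucc_comp_succ (k : ℕ) : koszulDSucc G a (k + 1) ≫ koszulDSucc G a k = 0 := by
  apply koszulSum_hom_ext
  intro S
  rw [koszulDSucc, koszulDSucc, ← Category.assoc, koszulSumι_desc, Preadditive.sum_comp, comp_zero]
  have key : ∀ s : {s // s ∈ S.1}, (koszulSign S.1 s.1 •
      (belowColimMap G (Finset.erase_subset s.1 S.1) ≫ koszulSumι G (S.erase s.1 s.2))) ≫
        (koszulSumDesc G a fun S : KoszulIdx a (k + 1) =>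
          ∑ s : {s // s ∈ S.1}, koszulSign S.1 s.1 •
          (belowColimMap G (Finset.erase_subset s.1 S.1) ≫ koszulSumι G (S.erase s.1 s.2))) =
        ∑ t : {t // t ∈ (S.erase s.1 s.2).1},
          (koszulSign S.1 s.1 * koszulSign (S.1.erase s.1) t.1) •
            (belowColimMap G (S := S.1) (T := ((S.erase s.1 s.2).erase t.1 t.2).1)
              ((Finset.erase_subset _ _).trans (Finset.erase_subset _ _)) ≫
              koszulSumι G ((S.erase s.1 s.2).erase t.1 t.2)) := fun s => by
    rw [Preadditive.zsmul_comp, Category.assoc, koszulSumι_desc, Preadditive.comp_sum,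
      Finset.smul_sum]
    refine Finset.sum_congr rfl fun t _ => ?_
    rw [Preadditive.comp_zsmul, ← Category.assoc, smul_smul]
    congr 2
    exact belowColimMap_comp G _ _
  simp only [key]
  rw [Finset.sum_sigma']
  refine Finset.sum_involution (fun x _ =>
    (⟨⟨x.2.1, Finset.mem_of_mem_erase x.2.2⟩, ⟨x.1.1, Finset.mem_erase.2
      ⟨(Finset.ne_of_mem_erase x.2.2).symm, x.1.2⟩⟩⟩ :
        Σ s : {s // s ∈ S.1}, {t // t ∈ (S.erase s.1 s.2).1})) ?_ ?_ ?_ ?_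
  · rintro ⟨⟨s, hs⟩, ⟨t, ht⟩⟩ _
    have hts := Finset.ne_of_mem_erase ht
    have htS := Finset.mem_of_mem_erase ht
    dsimp only
    rw [koszulSign_swap hs htS hts.symm, neg_smul, neg_add_eq_zero]
    congr 1
    apply belowColimMap_koszulSumι_congr
    apply Subtype.ext
    exact Finset.erase_right_comm
  · rintro ⟨⟨s, hs⟩, ⟨t, ht⟩⟩ _ _ h
    have hts := Finset.ne_of_mem_erase ht
    exact hts (congrArg (fun z => z.1.1) h)
  · intro _ _
    exact Finset.mem_sigma.2 ⟨Finset.mem_univ _, Finset.mem_univ _⟩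
  · intro _ _
    rfl

/-- The terms of the Koszul complex of `G` at `a`. -/
noncomputable def koszulX (G : J ⥤ ModuleCat.{w} K) (a : J) : ℕ → ModuleCat.{w} K
  | 0 => G.obj a
  | k + 1 => koszulSum G a (k + 1)

/-- The differentials of the Koszul complex. -/
noncomputable def koszulD : ∀ k : ℕ, koszulX G a (k + 1) ⟶ koszulX G a k
  | 0 => koszulDZero G a
  | k + 1 => koszulDSucc G a (k + 1)

theorem koszulD_comp : ∀ k : ℕ, koszulD G a (k + 1) ≫ koszulD G a k = 0
  | 0 => koszulDSucc_comp_zero G a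
  | k + 1 => koszulDSucc_comp_succ G a (k + 1)

/-- The Koszul complex `𝒦_a G` of a functor `G` on a finite poset at the element `a`, for a given
linear ordering of the parents of `a`. -/
noncomputable def koszulComplex : ChainComplex (ModuleCat.{w} K) ℕ :=
  ChainComplex.of (koszulX G a) (koszulD G a) (koszulD_comp G a)

end Koszul

/-! ## Koszul complexes on grids -/

section Grid

variable {K : Type u} [Field K] {I : Type v} [PartialOrder I]

/-- The inclusion `α : ℛ_D(I, V) ⊆ ℛ(I)` as a functor. -/
def gridIncl (D : Set I) (V : Set ℝ) : grid D V ⥤ Realisation I :=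
  Monotone.functor (f := fun x : grid D V => x.1) fun _ _ h => h

/-- The Koszul complex `𝒦_{(a, f)}(F α)` at a point `(a, f)` of the (finite) grid
`ℛ_{I ≤ d}(I, V)`, for `I` of finite type and `V` finite. -/
noncomputable def gridKoszul (hI : FiniteType I) (d : I) {V : Set ℝ} (hV : V.Finite)
    (F : Realisation I ⥤ ModuleCat.{w} K) (x : grid (Set.Iic d) V) [LinearOrder (Parent x)] :
    ChainComplex (ModuleCat.{w} K) ℕ :=
  have := grid_finite hI d hV
  koszulComplex (gridIncl (Set.Iic d) V ⋙ F) x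

end Grid

/-! ### Functors in terms of elements, radicals and bases of free functors -/

section FreeFunctors

variable {K : Type u} [Field K] {J : Type v} [PartialOrder J]

/-! Minimality of a resolution is a local condition: it holds exactly when every kernel, including
that of the augmentation, lies in the radical (`RadMinimal.isMinimal`, `IsMinimal.radMinimal`). A
free functor has a basis whose elements live in degrees of the poset, and its radical at `x` is
spanned by the generators of degree below `x`, so its Betti diagram at `x` is its value modulo the
radical. A cover with the least number of generators has its kernel in the radical, and Schanuel's
lemma (`HasRes.syzygy`) shows that its kernel can be resolved further; iterating gives the minimal
resolution.

Since all generators up to degree `i` lie in the grid, restriction to the grid keeps the resolution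
exact, free and minimal (`RadMinimal.minPres`), and the problem moves to a finite poset. There the
Koszul complex of a free functor is acyclic in positive degrees: for a generator below `a`,
inserting a chosen parent of `a` above that generator is a contracting homotopy (`htpy_identity`).
The zeroth homology is the value modulo the radical.

For a minimal cover `P` of `F` with kernel `Z`, the Koszul complexes form a right exact sequence,
since colimits are right exact. If it is also left exact in degrees `≤ i`, then `H_{i+1}` for `F` is
`H_i` for `Z` (`nonempty_iso_homology_succ`), and repeated dimension shifting ends at `H_0` of the
last syzygy, which is the Betti diagram. Left exactness in degree `k` holds when every set of `k`
parents with an ancestor has a greatest lower bound, because the colimit is then an evaluation.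

Computing `β^i` needs this only for `k < i`, so for `i < 3` only singletons matter, and the bound is
the parent itself. If some `ε` in `V` lies below all values of `f`, then all parents in the grid
have the base `a` (`Parent.base_eq`) and the bound is the pointwise minimum
(`exists_greatest_below`). For the vanishing statement, such an `ε` is adjoined to `V`; parents of
the same base pairwise have `(a, f)` as a sup, so a set of `i` parents with an ancestor would force
parental dimension at least `i`. Otherwise the Koszul complex is zero in degree `i`. -/

/-- The linear map `F(x ≤ y)`. -/
def res (F : J ⥤ ModuleCat.{w} K) {x y : J} (h : x ≤ y) : F.obj x →ₗ[K] F.obj y :=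
  (F.map (homOfLE h)).hom

@[simp]
theorem res_refl (F : J ⥤ ModuleCat.{w} K) {x : J} (h : x ≤ x) (v : F.obj x) : res F h v = v := by
  simp [res]

@[simp]
theorem res_res (F : J ⥤ ModuleCat.{w} K) {x y z : J} (h : x ≤ y) (h' : y ≤ z) (v : F.obj x) :
    res F h' (res F h v) = res F (h.trans h') v := by
  exact (congrArg (fun f : F.obj x ⟶ F.obj z => f.hom v)
    (F.map_comp (homOfLE h) (homOfLE h'))).symm

/-- The components of a natural transformation, as linear maps. -/
def appL {F G : J ⥤ ModuleCat.{w} K} (φ : F ⟶ G) (x : J) : F.obj x →ₗ[K] G.obj x :=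
  (φ.app x).hom

theorem appL_res {F G : J ⥤ ModuleCat.{w} K} (φ : F ⟶ G) {x y : J} (h : x ≤ y) (v : F.obj x) :
    appL φ y (res F h v) = res G h (appL φ x v) :=
  congrArg (fun f : F.obj x ⟶ G.obj y => f.hom v) (φ.naturality (homOfLE h))

@[simp]
theorem appL_id (F : J ⥤ ModuleCat.{w} K) (x : J) (v : F.obj x) : appL (𝟙 F) x v = v := rfl

@[simp]
theorem appL_comp {F G H : J ⥤ ModuleCat.{w} K} (φ : F ⟶ G) (ψ : G ⟶ H) (x : J) (v : F.obj x) :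
    appL (φ ≫ ψ) x v = appL ψ x (appL φ x v) := rfl

@[simp]
theorem appL_zero (F G : J ⥤ ModuleCat.{w} K) (x : J) (v : F.obj x) :
    appL (0 : F ⟶ G) x v = 0 := rfl

@[simp]
theorem appL_add {F G : J ⥤ ModuleCat.{w} K} (φ ψ : F ⟶ G) (x : J) (v : F.obj x) :
    appL (φ + ψ) x v = appL φ x v + appL ψ x v := rfl

@[simp]
theorem appL_sub {F G : J ⥤ ModuleCat.{w} K} (φ ψ : F ⟶ G) (x : J) (v : F.obj x) :
    appL (φ - ψ) x v = appL φ x v - appL ψ x v := rfl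

theorem appL_ext {F G : J ⥤ ModuleCat.{w} K} {φ ψ : F ⟶ G} (h : ∀ x v, appL φ x v = appL ψ x v) :
    φ = ψ := by
  ext x v
  exact h x v

/-- A natural transformation with given linear components. -/
def natMk {F G : J ⥤ ModuleCat.{w} K} (f : ∀ x, F.obj x →ₗ[K] G.obj x)
    (h : ∀ x y (hxy : x ≤ y) v, f y (res F hxy v) = res G hxy (f x v)) : F ⟶ G where
  app x := ModuleCat.ofHom (f x)
  naturality x y i := by
    ext v
    exact h x y (leOfHom i) v

@[simp]
theorem appL_natMk {F G : J ⥤ ModuleCat.{w} K} (f : ∀ x, F.obj x →ₗ[K] G.obj x)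
    (h : ∀ x y (hxy : x ≤ y) v, f y (res F hxy v) = res G hxy (f x v)) (x : J) :
    appL (natMk f h) x = f x := rfl

theorem isIso_of_bijective {F G : J ⥤ ModuleCat.{w} K} (φ : F ⟶ G)
    (h : ∀ x, Function.Bijective (appL φ x)) : IsIso φ := by
  have : ∀ x, IsIso (φ.app x) := fun x => (ConcreteCategory.isIso_iff_bijective _).2 (h x)
  exact NatIso.isIso_of_isIso_app φ

theorem bijective_of_isIso {F G : J ⥤ ModuleCat.{w} K} (φ : F ⟶ G) [IsIso φ] (x : J) :
    Function.Bijective (appL φ x) :=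
  (ConcreteCategory.isIso_iff_bijective (φ.app x)).1 inferInstance

theorem epi_iff_surjective_appL {F G : J ⥤ ModuleCat.{w} K} (φ : F ⟶ G) :
    Epi φ ↔ ∀ x, Function.Surjective (appL φ x) := by
  rw [NatTrans.epi_iff_epi_app]
  exact forall_congr' fun x => ModuleCat.epi_iff_surjective _

/-- Evaluation functors commute with homology and jointly detect zero objects, so exactness is
pointwise. -/
theorem exact_iff_appL {S : ShortComplex (J ⥤ ModuleCat.{w} K)} :
    S.Exact ↔ ∀ x (v : S.X₂.obj x), appL S.g x v = 0 → ∃ u, appL S.f x u = v := by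
  have h1 : S.Exact ↔ ∀ x, (S.map ((evaluation J (ModuleCat.{w} K)).obj x)).Exact := by
    simp only [ShortComplex.exact_iff_isZero_homology]
    rw [Functor.isZero_iff]
    refine forall_congr' fun x => ?_
    rw [ShortComplex.exact_iff_isZero_homology]
    exact (Iso.isZero_iff (S.mapHomologyIso ((evaluation J (ModuleCat.{w} K)).obj x))).symm
  rw [h1]
  exact forall_congr' fun x => ShortComplex.moduleCat_exact_iff _

/-- The radical of a functor at `x`: the sum of the images of the maps `F(y < x)`. -/
def rad (F : J ⥤ ModuleCat.{w} K) (x : J) : Submodule K (F.obj x) :=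
  ⨆ y : {y // y < x}, LinearMap.range (res F y.2.le)

theorem res_mem_rad (F : J ⥤ ModuleCat.{w} K) {x y : J} (h : y < x) (v : F.obj y) :
    res F h.le v ∈ rad F x :=
  Submodule.mem_iSup_of_mem (⟨y, h⟩ : {y // y < x}) ⟨v, rfl⟩

theorem rad_le {F : J ⥤ ModuleCat.{w} K} {x : J} {N : Submodule K (F.obj x)}
    (h : ∀ y (hy : y < x) (v : F.obj y), res F hy.le v ∈ N) : rad F x ≤ N :=
  iSup_le fun y => by
    rintro _ ⟨v, rfl⟩
    exact h y.1 y.2 v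

/-- A basis of a free functor: elements of `P(g k)` whose images in each `P(x)` form a basis. -/
structure FreeBasis (P : J ⥤ ModuleCat.{w} K) {κ : Type*} (g : κ → J) where
  b : ∀ x, Module.Basis {k // g k ≤ x} K (P.obj x)
  res_b : ∀ {x y} (h : x ≤ y) (k) (hk : g k ≤ x), res P h (b x ⟨k, hk⟩) = b y ⟨k, hk.trans h⟩

namespace FreeBasis

variable {P F : J ⥤ ModuleCat.{w} K} {κ : Type*} {g : κ → J} (B : FreeBasis P g)

/-- The generators of a free functor. -/
noncomputable def gen (k : κ) : P.obj (g k) := B.b (g k) ⟨k, le_rfl⟩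

theorem res_gen (k : κ) {x : J} (h : g k ≤ x) : res P h (B.gen k) = B.b x ⟨k, h⟩ :=
  B.res_b h k le_rfl

/-- The map from a free functor with given values on the generators. -/
noncomputable def lift (m : ∀ k, F.obj (g k)) : P ⟶ F :=
  natMk (fun x => (B.b x).constr K fun k => res F k.2 (m k)) fun x y h => by
    refine fun v => LinearMap.congr_fun (f := ((B.b y).constr K fun k => res F k.2 (m k)) ∘ₗ
      res P h) (g := res F h ∘ₗ ((B.b x).constr K fun k => res F k.2 (m k))) ?_ v
    refine (B.b x).ext ?_
    rintro ⟨k, hk⟩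
    simp [B.res_b]

@[simp]
theorem lift_b (m : ∀ k, F.obj (g k)) (x : J) (k : {k // g k ≤ x}) :
    appL (B.lift m) x (B.b x k) = res F k.2 (m k) := by
  simp [lift]

@[simp]
theorem lift_gen (m : ∀ k, F.obj (g k)) (k : κ) : appL (B.lift m) (g k) (B.gen k) = m k := by
  simp [gen]

include B in
theorem hom_ext {φ ψ : P ⟶ F} (h : ∀ k, appL φ (g k) (B.gen k) = appL ψ (g k) (B.gen k)) :
    φ = ψ := by
  refine appL_ext fun x => LinearMap.congr_fun ((B.b x).ext ?_)
  rintro ⟨k, hk⟩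
  rw [← B.res_gen, appL_res, appL_res, h]

include B in
theorem projective : Projective P where
  factors {E X} f e he := by
    have hs := (epi_iff_surjective_appL e).1 he
    choose m hm using fun k => hs (g k) (appL f (g k) (B.gen k))
    exact ⟨B.lift m, B.hom_ext fun k => by simp [hm]⟩

theorem repr_res {x y : J} (h : x ≤ y) (v : P.obj x) (k : {k // g k ≤ y}) (hk : ¬ g k ≤ x) :
    (B.b y).repr (res P h v) k = 0 := by
  refine LinearMap.congr_fun (f := (B.b y).coord k ∘ₗ res P h) (g := 0) ((B.b x).ext ?_) v
  rintro ⟨l, hl⟩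
  have : (⟨l, hl.trans h⟩ : {k // g k ≤ y}) ≠ k := by
    rintro rfl
    exact hk hl
  simp [B.res_b, Finsupp.single_eq_of_ne this.symm]

/-- An element coming from some `y < x` involves only generators of degree `≤ y`, hence none of
degree `x`; conversely, every generator of degree below `x` already lies in the radical. -/
theorem mem_rad_iff {x : J} {z : P.obj x} :
    z ∈ rad P x ↔ ∀ k : {k // g k ≤ x}, g k = x → (B.b x).repr z k = 0 := by
  constructor
  · intro hz k hk
    have : rad P x ≤ LinearMap.ker ((B.b x).coord k) := rad_le fun y hy v => by
      rw [LinearMap.mem_ker]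
      exact B.repr_res hy.le v k (by rw [hk]; exact not_le_of_gt hy)
    exact this hz
  · intro h
    rw [← (B.b x).linearCombination_repr z, Finsupp.linearCombination_apply]
    refine Submodule.sum_mem _ fun k _ => ?_
    dsimp only
    by_cases hk : g k = x
    · rw [h k hk, zero_smul]
      exact Submodule.zero_mem _
    · rw [← B.res_gen k k.2]
      exact Submodule.smul_mem _ _ (res_mem_rad P (lt_of_le_of_ne k.2 hk) _)

/-- The projection of `P(x)` onto its top. -/
noncomputable def top {x : J} {W : Type*} [AddCommGroup W] [Module K W]
    (bw : Module.Basis {k // g k = x} K W) : P.obj x →ₗ[K] W :=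
  open Classical in (B.b x).constr K fun k => if h : g k = x then bw ⟨k, h⟩ else 0

theorem repr_top {x : J} {W : Type*} [AddCommGroup W] [Module K W]
    (bw : Module.Basis {k // g k = x} K W) (z : P.obj x) (k : {k // g k = x}) :
    bw.repr (B.top bw z) k = (B.b x).repr z ⟨k, k.2.le⟩ := by
  refine LinearMap.congr_fun (f := bw.coord k ∘ₗ B.top bw)
    (g := (B.b x).coord ⟨k, k.2.le⟩) ((B.b x).ext ?_) z
  rintro ⟨l, hl⟩
  obtain ⟨k, hk⟩ := k
  by_cases h : g l = x
  · by_cases hkl : l = k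
    · subst hkl
      simp [top, h]
    · simp [top, h, hkl]
  · have : l ≠ k := by
      rintro rfl
      exact h hk
    simp [top, h, this]

/-- This identifies the Betti diagram at `x` with the quotient of `P(x)` by the radical, the form in
which it is compared with Koszul homology. -/
theorem ker_top {x : J} {W : Type*} [AddCommGroup W] [Module K W]
    (bw : Module.Basis {k // g k = x} K W) : LinearMap.ker (B.top bw) = rad P x := by
  ext z
  rw [B.mem_rad_iff, LinearMap.mem_ker, ← bw.repr.map_eq_zero_iff, Finsupp.ext_iff]
  constructor
  · intro h k hk
    exact (B.repr_top bw z ⟨k, hk⟩).symm.trans (h ⟨k, hk⟩)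
  · intro h k
    rw [B.repr_top]
    exact h ⟨k, k.2.le⟩ k.2

theorem top_surjective {x : J} {W : Type*} [AddCommGroup W] [Module K W]
    (bw : Module.Basis {k // g k = x} K W) : Function.Surjective (B.top bw) := by
  rw [← LinearMap.range_eq_top, eq_top_iff, ← bw.span_eq, Submodule.span_le]
  rintro _ ⟨⟨k, hk⟩, rfl⟩
  exact ⟨B.b x ⟨k, hk.le⟩, by simp [top, hk]⟩

include B in
theorem module_finite [Finite κ] (x : J) : Module.Finite K (P.obj x) :=
  Module.Finite.of_basis (B.b x)

/-- Transport of a basis along an isomorphism of functors. -/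
noncomputable def ofIso {Q : J ⥤ ModuleCat.{w} K} (e : P ≅ Q) : FreeBasis Q g where
  b x := (B.b x).map (e.app x).toLinearEquiv
  res_b {x y} h k hk := by
    have := appL_res e.hom h (B.b x ⟨k, hk⟩)
    rw [B.res_b] at this
    exact this.symm

/-- Restriction of a free functor to a subposet containing the degrees of its generators. -/
noncomputable def restrict {G : Set J} (ι : G ⥤ J) (hι : ∀ x : G, ι.obj x = x.1)
    (hg : ∀ k, g k ∈ G) : FreeBasis (ι ⋙ P) (fun k => (⟨g k, hg k⟩ : G)) where
  b x := (B.b (ι.obj x)).reindex (Equiv.subtypeEquivRight fun k => by rw [hι]; rfl)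
  res_b {x y} h k hk := by
    simp only [Module.Basis.reindex_apply]
    exact B.res_b (leOfHom (ι.map (homOfLE h))) k _

include B in
/-- Nakayama's lemma for free functors. -/
theorem nakayama [Finite κ] (N : ∀ x, Submodule K (P.obj x))
    (hN : ∀ {x y} (h : x ≤ y) (v), v ∈ N x → res P h v ∈ N y)
    (hrad : ∀ x, N x ⊔ rad P x = ⊤) (x : J) : N x = ⊤ := by
  have key : ∀ k, B.gen k ∈ N (g k) := by
    by_contra! hk
    -- Take a generator outside `N` of minimal degree: the radical in that degree comes from
    -- generators of smaller degree, so it lies in `N` and adds nothing to it.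
    obtain ⟨_, ⟨k, hk, rfl⟩, hmin⟩ := ((Set.finite_range g).subset
      (Set.image_subset_range g {k | B.gen k ∉ N (g k)})).exists_minimal (Set.Nonempty.image g hk)
    apply hk
    have h1 : B.gen k ∈ N (g k) ⊔ rad P (g k) := by rw [hrad]; trivial
    have h2 : rad P (g k) ≤ N (g k) := rad_le fun z hz v => by
      apply hN
      rw [← (B.b z).linearCombination_repr v, Finsupp.linearCombination_apply]
      refine Submodule.sum_mem _ fun l _ => Submodule.smul_mem _ _ ?_
      rw [← B.res_gen l l.2]
      apply hN
      by_contra hl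
      exact absurd (hmin ⟨l.1, hl, rfl⟩ (l.2.trans hz.le)) (not_le_of_gt (l.2.trans_lt hz))
    rwa [sup_eq_left.2 h2] at h1
  rw [eq_top_iff, ← (B.b x).span_eq, Submodule.span_le]
  rintro _ ⟨⟨k, hk⟩, rfl⟩
  rw [← B.res_gen]
  exact hN _ _ (key k)

variable {W : J → ModuleCat.{w} K}

/-- The inclusion of the Betti diagram into a free functor. -/
noncomputable def unit (bw : ∀ a, Module.Basis {k // g k = a} K (W a)) :
    Discrete.functor W ⟶ Discrete.functor (fun a : J => a) ⋙ P :=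
  Discrete.natTrans fun a => ModuleCat.ofHom ((bw a.as).constr K fun k => B.b a.as ⟨k, k.2.le⟩)

theorem unit_apply (bw : ∀ a, Module.Basis {k // g k = a} K (W a)) (k : κ) :
    ((B.unit bw).app ⟨g k⟩).hom (bw (g k) ⟨k, rfl⟩) = B.gen k :=
  (bw (g k)).constr_basis K _ _

/-- The map out of a free functor induced by a map out of its Betti diagram. -/
noncomputable def desc (bw : ∀ a, Module.Basis {k // g k = a} K (W a))
    (δ : Discrete.functor W ⟶ Discrete.functor (fun a : J => a) ⋙ F) : P ⟶ F :=
  B.lift fun k => (δ.app ⟨g k⟩).hom (bw (g k) ⟨k, rfl⟩)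

theorem unit_desc (bw : ∀ a, Module.Basis {k // g k = a} K (W a))
    (δ : Discrete.functor W ⟶ Discrete.functor (fun a : J => a) ⋙ F) :
    B.unit bw ≫ Functor.whiskerLeft _ (B.desc bw δ) = δ := by
  ext ⟨a⟩ : 2
  apply ModuleCat.hom_ext
  refine (bw a).ext ?_
  rintro ⟨k, rfl⟩
  exact (congrArg (appL (B.desc bw δ) (g k)) (B.unit_apply bw k)).trans (B.lift_gen _ k)

theorem desc_uniq (bw : ∀ a, Module.Basis {k // g k = a} K (W a))
    (δ : Discrete.functor W ⟶ Discrete.functor (fun a : J => a) ⋙ F) (φ : P ⟶ F)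
    (h : B.unit bw ≫ Functor.whiskerLeft _ φ = δ) : φ = B.desc bw δ := by
  refine B.hom_ext fun k => (?_ : _ = _).trans (B.lift_gen _ k).symm
  rw [← h, ← B.unit_apply bw]
  rfl

/-- Maps out of `P` are determined, freely, by the images of the generators, and these amount to a
map out of `W`. -/
theorem isLeftKanExtension (bw : ∀ a, Module.Basis {k // g k = a} K (W a)) :
    P.IsLeftKanExtension (B.unit bw) where
  nonempty_isUniversal := by
    refine ⟨IsInitial.ofUniqueHom (fun Y => StructuredArrow.homMk
      (B.desc (F := Y.right) bw Y.hom) (B.unit_desc bw Y.hom)) ?_⟩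
    intro Y m
    exact StructuredArrow.ext _ _ (B.desc_uniq bw Y.hom m.right (StructuredArrow.w m))

include B in
theorem hasBettiDiagram [Finite κ] (bw : ∀ a, Module.Basis {k // g k = a} K (W a)) :
    HasBettiDiagram P W := by
  refine ⟨fun a => Module.Finite.of_basis (bw a), (Set.finite_range g).subset fun a ha => ?_,
    B.unit bw, B.isLeftKanExtension bw⟩
  by_contra h
  have : IsEmpty {k // g k = a} := ⟨fun k => h ⟨k.1, k.2⟩⟩
  have := (bw a).repr.toEquiv.subsingleton
  exact not_subsingleton_iff_nontrivial.2 ha this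

end FreeBasis

end FreeFunctors

/-! ### Construction of free functors and minimal covers -/

section FreeFunctors

variable {K : Type u} [Field K] {J : Type v} [PartialOrder J]

/-- The inclusion of the generators in degrees `≤ x` into those in degrees `≤ y`. -/
def degIncl {κ : Type*} (g : κ → J) {x y : J} (h : x ≤ y) (k : {k // g k ≤ x}) : {k // g k ≤ y} :=
  ⟨k.1, k.2.trans h⟩

/-- The functor with one copy of `L` generated at each `g k`. -/
noncomputable def freeOn (L : ModuleCat.{w} K) {κ : Type} (g : κ → J) : J ⥤ ModuleCat.{w} K where
  obj x := ModuleCat.of K ({k // g k ≤ x} →₀ L)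
  map i := ModuleCat.ofHom (Finsupp.lmapDomain L K (degIncl g (leOfHom i)))
  map_id x := by
    ext : 1
    exact Finsupp.lmapDomain_id L K
  map_comp i j := by
    ext : 1
    exact Finsupp.lmapDomain_comp L K (degIncl g (leOfHom i)) (degIncl g (leOfHom j))

/-- The basis of a value of `freeOn L g`, if `L` is one-dimensional. -/
noncomputable def freeOnBasisAt (L : ModuleCat.{w} K) {κ : Type} (g : κ → J)
    (bL : κ → Module.Basis Unit K L) (x : J) :
    Module.Basis {k // g k ≤ x} K ({k // g k ≤ x} →₀ L) :=
  (Finsupp.basis fun k : {k // g k ≤ x} => bL k.1).reindex (Equiv.sigmaUnique _ _)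

theorem freeOnBasisAt_apply (L : ModuleCat.{w} K) {κ : Type} (g : κ → J)
    (bL : κ → Module.Basis Unit K L) (x : J) (k : {k // g k ≤ x}) :
    freeOnBasisAt L g bL x k = Finsupp.single k (bL k.1 ()) := by
  simp [freeOnBasisAt, Finsupp.coe_basis]

/-- The basis of `freeOn L g`, if `L` is one-dimensional. -/
noncomputable def freeOnBasis (L : ModuleCat.{w} K) {κ : Type} (g : κ → J)
    (bL : κ → Module.Basis Unit K L) : FreeBasis (freeOn L g) g where
  b x := (freeOnBasisAt L g bL x)
  res_b {x y} h k hk := by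
    refine (congrArg (Finsupp.lmapDomain L K (degIncl g h))
      (freeOnBasisAt_apply L g bL x ⟨k, hk⟩)).trans ?_
    exact Finsupp.mapDomain_single.trans (freeOnBasisAt_apply L g bL y _).symm

/-- The universes of `K` and of the modules are unrelated, so a one-dimensional space in the right
universe has to be cut out of a given non-zero module as the span of a vector. -/
theorem exists_freeBasis {κ : Type} (g : κ → J)
    (h : κ → ∃ M : ModuleCat.{w} K, Nontrivial M) :
    ∃ P : J ⥤ ModuleCat.{w} K, Nonempty (FreeBasis P g) := by
  rcases isEmpty_or_nonempty κ with hκ | ⟨⟨k⟩⟩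
  · exact ⟨freeOn (ModuleCat.of K PUnit) g, ⟨freeOnBasis _ g fun k => isEmptyElim k⟩⟩
  · obtain ⟨M, hM⟩ := h k
    obtain ⟨v, hv⟩ := exists_ne (0 : M)
    exact ⟨freeOn (ModuleCat.of K (K ∙ v)) g, ⟨freeOnBasis _ g fun _ =>
      (Module.Basis.singleton Unit K).map (LinearEquiv.toSpanNonzeroSingleton K M v hv)⟩⟩

/-- An explicit free functor with generators indexed by bases of the `W a` is another left Kan
extension of `W`; uniqueness of Kan extensions transports its basis to `P`. -/
theorem HasBettiDiagram.exists_freeBasis {P : J ⥤ ModuleCat.{w} K} {W : J → ModuleCat.{w} K}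
    (h : HasBettiDiagram P W) : ∃ (m : ℕ) (g : Fin m → J), Nonempty (FreeBasis P g) ∧
      ∀ a, Nonempty (Module.Basis {k // g k = a} K (W a)) := by
  obtain ⟨hW, hsupp, η, hη⟩ := h
  have : Finite (supp W) := hsupp
  have hnt : ∀ k : Σ a, Fin (Module.finrank K (W a)), Nontrivial (W k.1) := fun k =>
    Module.nontrivial_of_finrank_pos (R := K) k.2.pos
  have : Finite (Σ a, Fin (Module.finrank K (W a))) :=
    Finite.of_injective (β := Σ a : supp W, Fin (Module.finrank K (W a.1)))
      (fun k => ⟨⟨k.1, hnt k⟩, k.2⟩) (by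
        rintro ⟨a, i⟩ ⟨b, j⟩ h
        obtain ⟨h1, h2⟩ := Sigma.mk.inj_iff.1 h
        obtain rfl : a = b := congrArg Subtype.val h1
        obtain rfl : i = j := eq_of_heq h2
        rfl)
  obtain ⟨m, ⟨e⟩⟩ := Finite.exists_equiv_fin (Σ a, Fin (Module.finrank K (W a)))
  obtain ⟨Q, ⟨B⟩⟩ := _root_.exists_freeBasis.{u, v, w} (K := K) (fun k => (e.symm k).1)
    fun k => ⟨_, hnt (e.symm k)⟩
  have bw : ∀ a, Module.Basis {k // (e.symm k).1 = a} K (W a) := fun a =>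
    (Module.finBasis K (W a)).reindex ((Equiv.sigmaSubtype a).symm.trans
      (e.subtypeEquiv fun k => by simp))
  have := B.isLeftKanExtension bw
  exact ⟨m, _, ⟨B.ofIso (Functor.leftKanExtensionUnique Q (B.unit bw) P η)⟩, fun a => ⟨bw a⟩⟩

/-- The Betti diagram is taken inside the values of `P`, as the span of the generators of degree
exactly `a`, which keeps it in the same universe. -/
theorem FreeBasis.isFree {P : J ⥤ ModuleCat.{w} K} {κ : Type*} [Finite κ] {g : κ → J}
    (B : FreeBasis P g) : IsFree P := by
  have hli : ∀ a, LinearIndependent K fun k : {k // g k = a} => B.b a ⟨k.1, k.2.le⟩ := fun a =>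
    (B.b a).linearIndependent.comp (fun k : {k // g k = a} => ⟨k.1, k.2.le⟩) fun k l h => by
      simpa [Subtype.ext_iff] using h
  exact ⟨fun a => ModuleCat.of K (Submodule.span K
    (Set.range fun k : {k // g k = a} => B.b a ⟨k.1, k.2.le⟩)),
    B.hasBettiDiagram fun a => Module.Basis.span (hli a)⟩

theorem IsFree.exists_freeBasis {P : J ⥤ ModuleCat.{w} K} (h : IsFree P) :
    ∃ (m : ℕ) (g : Fin m → J), Nonempty (FreeBasis P g) := by
  obtain ⟨W, hW⟩ := h
  obtain ⟨m, g, hB, -⟩ := hW.exists_freeBasis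
  exact ⟨m, g, hB⟩

theorem IsFree.projective {P : J ⥤ ModuleCat.{w} K} (h : IsFree P) : Projective P := by
  obtain ⟨m, g, ⟨B⟩⟩ := h.exists_freeBasis
  exact B.projective

/-- The elements `f k` of `F(g k)` generate `F`. -/
def Generates (F : J ⥤ ModuleCat.{w} K) {κ : Type*} (g : κ → J) (f : ∀ k, F.obj (g k)) : Prop :=
  ∀ x, Submodule.span K (Set.range fun k : {k // g k ≤ x} => res F k.2 (f k)) = ⊤

theorem FreeBasis.generates_of_epi {P F : J ⥤ ModuleCat.{w} K} {κ : Type*} {g : κ → J}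
    (B : FreeBasis P g) (π : P ⟶ F) (hπ : ∀ x, Function.Surjective (appL π x)) :
    Generates F g fun k => appL π (g k) (B.gen k) := by
  intro x
  rw [← LinearMap.range_eq_top.2 (hπ x), ← Submodule.map_top, ← (B.b x).span_eq,
    Submodule.map_span, ← Set.range_comp]
  congr 2
  funext ⟨k, hk⟩
  rw [← appL_res, B.res_gen]
  rfl

theorem FreeBasis.lift_surjective {P F : J ⥤ ModuleCat.{w} K} {κ : Type*} {g : κ → J}
    (B : FreeBasis P g) {f : ∀ k, F.obj (g k)} (hf : Generates F g f) (x : J) :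
    Function.Surjective (appL (B.lift f) x) := by
  rw [← LinearMap.range_eq_top, eq_top_iff, ← hf x, Submodule.span_le]
  rintro _ ⟨k, rfl⟩
  exact ⟨B.b x k, B.lift_b f x k⟩

/-- The kernel of a map is contained in the radical. -/
def KerLeRad {P F : J ⥤ ModuleCat.{w} K} (π : P ⟶ F) : Prop :=
  ∀ x v, appL π x v = 0 → v ∈ rad P x

/-- A finitely generated functor has a minimal cover. -/
theorem exists_minimal_cover {P F : J ⥤ ModuleCat.{w} K} (hP : IsFree P) (π : P ⟶ F) [hπ : Epi π] :
    ∃ (Q : J ⥤ ModuleCat.{w} K) (ρ : Q ⟶ F), IsFree Q ∧ Epi ρ ∧ KerLeRad ρ := by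
  classical
  obtain ⟨m₀, g₀, ⟨B₀⟩⟩ := hP.exists_freeBasis
  have hex : ∃ (m : ℕ) (g : Fin m → J) (f : ∀ k, F.obj (g k)), Generates F g f :=
    ⟨m₀, g₀, _, B₀.generates_of_epi π ((epi_iff_surjective_appL π).1 hπ)⟩
  obtain ⟨g, f, hf⟩ := Nat.find_spec hex
  have hmin : ∀ m' < Nat.find hex, ¬ ∃ (g : Fin m' → J) (f : ∀ k, F.obj (g k)), Generates F g f :=
    fun m' h => Nat.find_min hex h
  generalize Nat.find hex = m at g f hf hmin
  -- A generator in the span of the others at its own degree is redundant everywhere, which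
  -- contradicts the minimality of `m`.
  have hdrop : ∀ k₀ : Fin m, (res F le_rfl (f k₀) ∈ Submodule.span K (Set.range
      fun k : {k : {k // k ≠ k₀} // g k ≤ g k₀} => res F k.2 (f k.1))) → False := by
    intro k₀ hk₀
    obtain ⟨m', ⟨e⟩⟩ := Finite.exists_equiv_fin {k // k ≠ k₀}
    refine hmin m' ?_ ⟨fun i => g (e.symm i).1, fun i => f (e.symm i).1, fun x => ?_⟩
    · have h1 := Nat.card_congr e
      have h2 : Nat.card {k // k ≠ k₀} < Nat.card (Fin m) := Finite.card_subtype_lt (x := k₀) (by simp)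
      simp only [Nat.card_eq_fintype_card, Fintype.card_fin] at h1 h2 ⊢
      omega
    · rw [eq_top_iff, ← hf x, Submodule.span_le]
      rintro _ ⟨⟨k, hk⟩, rfl⟩
      by_cases hkk : k = k₀
      · subst hkk
        have h3 := Submodule.mem_map_of_mem (f := res F hk) hk₀
        rw [Submodule.map_span, ← Set.range_comp, res_res] at h3
        refine Submodule.span_mono ?_ h3
        rintro _ ⟨⟨l, hl⟩, rfl⟩
        refine ⟨⟨e l, by simpa using hl.trans hk⟩, ?_⟩
        simp only [Function.comp_apply, res_res]
        have : ∀ l' : {l // l ≠ k}, l' = l → ∀ h : g l'.1 ≤ x,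
            res F h (f l'.1) = res F (hl.trans hk) (f l.1) := by
          rintro _ rfl _
          rfl
        exact this _ (e.symm_apply_apply l) _
      · refine Submodule.subset_span ⟨⟨e ⟨k, hkk⟩, by simpa using hk⟩, ?_⟩
        have : ∀ l' : {l // l ≠ k₀}, l' = ⟨k, hkk⟩ → ∀ h : g l'.1 ≤ x,
            res F h (f l'.1) = res F hk (f k) := by
          rintro _ rfl _
          rfl
        exact this _ (e.symm_apply_apply _) _
  -- A zero generator would be redundant, so each `F.obj (g k)` supplies the non-zero module needed
  -- here.
  obtain ⟨Q, ⟨B⟩⟩ := exists_freeBasis.{u, v, w} (K := K) g fun k => by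
    refine ⟨F.obj (g k), nontrivial_of_ne (f k) 0 fun h0 => hdrop k ?_⟩
    rw [h0, map_zero]
    exact Submodule.zero_mem _
  refine ⟨Q, B.lift f, B.isFree, (epi_iff_surjective_appL _).2 (B.lift_surjective hf), ?_⟩
  intro x v hv
  rw [B.mem_rad_iff]
  rintro ⟨k₀, hk₀⟩ (rfl : g k₀ = x)
  by_contra hc
  apply hdrop k₀
  set c := (B.b (g k₀)).repr v ⟨k₀, hk₀⟩ with hcdef
  rw [← (B.b (g k₀)).sum_repr v, map_sum, ← Finset.add_sum_erase _ _
    (Finset.mem_univ (⟨k₀, hk₀⟩ : {k // g k ≤ g k₀})), add_eq_zero_iff_eq_neg, map_smul,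
    B.lift_b, ← hcdef, ← Finset.sum_neg_distrib] at hv
  -- A relation with non-zero coefficient `c` at `k₀` can be solved for the generator `f k₀`, which
  -- makes it redundant.
  rw [← inv_smul_smul₀ hc (res F le_rfl (f k₀)), hv]
  refine Submodule.smul_mem _ _ (Submodule.sum_mem _ fun k hk => Submodule.neg_mem _ ?_)
  rw [map_smul, B.lift_b]
  refine Submodule.smul_mem _ _ (Submodule.subset_span ⟨⟨⟨k.1, ?_⟩, k.2⟩, rfl⟩)
  intro h
  exact Finset.ne_of_mem_erase hk (Subtype.ext h)

end FreeFunctors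

/-! ### Short exact sequences, finite-length resolvability and Schanuel's lemma -/

section Resolvability

variable {K : Type u} [Field K] {J : Type v} [PartialOrder J]

/-- A short exact sequence of functors, in terms of elements. -/
structure IsSES {Z P F : J ⥤ ModuleCat.{w} K} (ι : Z ⟶ P) (π : P ⟶ F) : Prop where
  inj : ∀ x, Function.Injective (appL ι x)
  exact : ∀ x v, appL π x v = 0 ↔ ∃ u, appL ι x u = v
  surj : ∀ x, Function.Surjective (appL π x)

theorem appL_kernel_ι_injective {P F : J ⥤ ModuleCat.{w} K} (π : P ⟶ F) (x : J) :
    Function.Injective (appL (kernel.ι π) x) :=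
  (ModuleCat.mono_iff_injective ((kernel.ι π).app x)).1 inferInstance

theorem appL_eq_zero_iff_kernel {P F : J ⥤ ModuleCat.{w} K} (π : P ⟶ F) (x : J) (v : P.obj x) :
    appL π x v = 0 ↔ ∃ u, appL (kernel.ι π) x u = v := by
  constructor
  · exact exact_iff_appL.1 (ShortComplex.exact_kernel π) x v
  · rintro ⟨u, rfl⟩
    rw [← appL_comp, kernel.condition]
    rfl

theorem isSES_kernel {P F : J ⥤ ModuleCat.{w} K} (π : P ⟶ F)
    (h : ∀ x, Function.Surjective (appL π x)) : IsSES (kernel.ι π) π :=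
  ⟨appL_kernel_ι_injective π, appL_eq_zero_iff_kernel π, h⟩

theorem IsSES.comp_eq_zero {Z P F : J ⥤ ModuleCat.{w} K} {ι : Z ⟶ P} {π : P ⟶ F}
    (h : IsSES ι π) : ι ≫ π = 0 :=
  appL_ext fun x v => (h.exact x _).2 ⟨v, rfl⟩

theorem IsSES.exists_lift {Z P F : J ⥤ ModuleCat.{w} K} {ι : Z ⟶ P} {π : P ⟶ F} (h : IsSES ι π)
    {X : J ⥤ ModuleCat.{w} K} (f : X ⟶ P) (hf : ∀ x v, appL π x (appL f x v) = 0) :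
    ∃ k : X ⟶ Z, ∀ x v, appL ι x (appL k x v) = appL f x v := by
  choose k hk using fun x (v : X.obj x) => (h.exact x _).1 (hf x v)
  refine ⟨natMk (fun x =>
    { toFun := k x
      map_add' := fun v v' => h.inj x (by simp [hk])
      map_smul' := fun r v => h.inj x (by simp [hk]) }) fun x y hxy v => h.inj y ?_, hk⟩
  simp [hk, appL_res]

theorem IsFree.exists_lift {P X F : J ⥤ ModuleCat.{w} K} (hP : IsFree P) (π : X ⟶ F)
    (hπ : ∀ x, Function.Surjective (appL π x)) (f : P ⟶ F) :
    ∃ k : P ⟶ X, ∀ x v, appL π x (appL k x v) = appL f x v := by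
  have := hP.projective
  have := (epi_iff_surjective_appL π).2 hπ
  refine ⟨Projective.factorThru f π, fun x v => ?_⟩
  rw [← appL_comp, Projective.factorThru_comp]

section Biprod

variable {A B X : J ⥤ ModuleCat.{w} K}

@[simp]
theorem appL_fst_inl (x : J) (v : A.obj x) :
    appL (biprod.fst : A ⊞ B ⟶ A) x (appL (biprod.inl : A ⟶ A ⊞ B) x v) = v := by
  rw [← appL_comp, biprod.inl_fst, appL_id]

@[simp]
theorem appL_snd_inl (x : J) (v : A.obj x) :
    appL (biprod.snd : A ⊞ B ⟶ B) x (appL (biprod.inl : A ⟶ A ⊞ B) x v) = 0 := by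
  rw [← appL_comp, biprod.inl_snd, appL_zero]

@[simp]
theorem appL_fst_inr (x : J) (v : B.obj x) :
    appL (biprod.fst : A ⊞ B ⟶ A) x (appL (biprod.inr : B ⟶ A ⊞ B) x v) = 0 := by
  rw [← appL_comp, biprod.inr_fst, appL_zero]

@[simp]
theorem appL_snd_inr (x : J) (v : B.obj x) :
    appL (biprod.snd : A ⊞ B ⟶ B) x (appL (biprod.inr : B ⟶ A ⊞ B) x v) = v := by
  rw [← appL_comp, biprod.inr_snd, appL_id]

theorem appL_biprod_total (x : J) (v : (A ⊞ B).obj x) :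
    appL biprod.inl x (appL biprod.fst x v) + appL biprod.inr x (appL biprod.snd x v) = v := by
  rw [← appL_comp, ← appL_comp, ← appL_add, biprod.total, appL_id]

theorem appL_biprod_ext {x : J} {v v' : (A ⊞ B).obj x}
    (h1 : appL biprod.fst x v = appL biprod.fst x v')
    (h2 : appL biprod.snd x v = appL biprod.snd x v') : v = v' := by
  rw [← appL_biprod_total x v, ← appL_biprod_total x v', h1, h2]

theorem appL_desc (f : A ⟶ X) (g : B ⟶ X) (x : J) (v : (A ⊞ B).obj x) :
    appL (biprod.desc f g) x v = appL f x (appL biprod.fst x v) + appL g x (appL biprod.snd x v) := by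
  rw [biprod.desc_eq]
  rfl

@[simp]
theorem appL_fst_lift (f : X ⟶ A) (g : X ⟶ B) (x : J) (v : X.obj x) :
    appL biprod.fst x (appL (biprod.lift f g) x v) = appL f x v := by
  rw [← appL_comp, biprod.lift_fst]

@[simp]
theorem appL_snd_lift (f : X ⟶ A) (g : X ⟶ B) (x : J) (v : X.obj x) :
    appL biprod.snd x (appL (biprod.lift f g) x v) = appL g x v := by
  rw [← appL_comp, biprod.lift_snd]

/-- The values of a biproduct are products. -/
noncomputable def biprodEquiv (A B : J ⥤ ModuleCat.{w} K) (x : J) :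
    (A ⊞ B).obj x ≃ₗ[K] A.obj x × B.obj x :=
  LinearEquiv.ofLinearMap ((appL biprod.fst x).prod (appL biprod.snd x))
    ((appL biprod.inl x).coprod (appL biprod.inr x)) (by ext <;> simp)
    (by ext v; simp [appL_biprod_total])

end Biprod

/-- The biproduct of two free functors is free. -/
noncomputable def FreeBasis.biprod {P Q : J ⥤ ModuleCat.{w} K} {κ μ : Type*} {g : κ → J}
    {h : μ → J} (B : FreeBasis P g) (C : FreeBasis Q h) : FreeBasis (P ⊞ Q) (Sum.elim g h) where
  b x := (((B.b x).prod (C.b x)).map (biprodEquiv P Q x).symm).reindex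
    (Equiv.subtypeSum (p := fun s => Sum.elim g h s ≤ x)).symm
  res_b {x y} hxy := by
    rintro (k | k) hk
    · have h1 := appL_res (biprod.inl : P ⟶ P ⊞ Q) hxy (B.b x ⟨k, hk⟩)
      rw [B.res_b hxy k hk] at h1
      simpa [Equiv.subtypeSum, biprodEquiv] using h1.symm
    · have h1 := appL_res (biprod.inr : Q ⟶ P ⊞ Q) hxy (C.b x ⟨k, hk⟩)
      rw [C.res_b hxy k hk] at h1
      simpa [Equiv.subtypeSum, biprodEquiv] using h1.symm

theorem IsFree.biprod {P Q : J ⥤ ModuleCat.{w} K} (hP : IsFree P) (hQ : IsFree Q) :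
    IsFree (P ⊞ Q) := by
  obtain ⟨m, g, ⟨B⟩⟩ := hP.exists_freeBasis
  obtain ⟨m', g', ⟨B'⟩⟩ := hQ.exists_freeBasis
  exact (B.biprod B').isFree

/-- `F` has a free resolution of length `m`. -/
def HasRes : ℕ → (J ⥤ ModuleCat.{w} K) → Prop
  | 0, _ => True
  | m + 1, F => ∃ (Z P : J ⥤ ModuleCat.{w} K) (ι : Z ⟶ P) (π : P ⟶ F),
      IsFree P ∧ IsSES ι π ∧ HasRes m Z

theorem HasRes.of_bijective {m : ℕ} {F G : J ⥤ ModuleCat.{w} K} (h : HasRes m F) (φ : F ⟶ G)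
    (hφ : ∀ x, Function.Bijective (appL φ x)) : HasRes m G := by
  cases m with
  | zero => trivial
  | succ m =>
    obtain ⟨Z, P, ι, π, hP, hS, hZ⟩ := h
    refine ⟨Z, P, ι, π ≫ φ, hP, ⟨hS.inj, fun x v => ?_, fun x => (hφ x).2.comp (hS.surj x)⟩, hZ⟩
    rw [← hS.exact, appL_comp]
    exact map_eq_zero_iff _ (hφ x).1

theorem HasRes.biprod {m : ℕ} {A Q : J ⥤ ModuleCat.{w} K} (h : HasRes m A) (hQ : IsFree Q) :
    HasRes m (A ⊞ Q) := by
  cases m with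
  | zero => trivial
  | succ m =>
    obtain ⟨Z, P, ι, π, hP, hS, hZ⟩ := h
    refine ⟨Z, P ⊞ Q, ι ≫ biprod.inl, biprod.lift (biprod.fst ≫ π) biprod.snd,
      hP.biprod hQ, ⟨fun x v v' h => ?_, fun x v => ⟨fun h => ?_, ?_⟩, fun x v => ?_⟩, hZ⟩
    · apply hS.inj x
      simpa using congrArg (appL biprod.fst x) h
    · have h1 : appL π x (appL biprod.fst x v) = 0 := by
        simpa using congrArg (appL biprod.fst x) h
      have h2 : appL biprod.snd x v = 0 := by
        simpa using congrArg (appL biprod.snd x) h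
      obtain ⟨u, hu⟩ := (hS.exact x _).1 h1
      exact ⟨u, appL_biprod_ext (by simp [hu]) (by simp [h2])⟩
    · rintro ⟨u, rfl⟩
      exact appL_biprod_ext (by simpa using (hS.exact x _).2 ⟨u, rfl⟩) (by simp)
    · obtain ⟨u, hu⟩ := hS.surj x (appL biprod.fst x v)
      exact ⟨appL biprod.inl x u + appL biprod.inr x (appL biprod.snd x v),
        appL_biprod_ext (by simp [hu]) (by simp)⟩

/-- The free summand moves into the syzygy: `Q` lifts through the cover `P` of `A ⊞ Q`, so the
kernel of the composite from `P` to `A` is `Z ⊞ Q`. -/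
theorem HasRes.of_biprod {m : ℕ} {A Q : J ⥤ ModuleCat.{w} K} (h : HasRes m (A ⊞ Q))
    (hQ : IsFree Q) : HasRes m A := by
  cases m with
  | zero => trivial
  | succ m =>
    obtain ⟨Z, P, ι, π, hP, hS, hZ⟩ := h
    obtain ⟨q, hq⟩ := hQ.exists_lift π hS.surj biprod.inr
    have hι : ∀ x v, appL π x (appL ι x v) = 0 := fun x v => (hS.exact x _).2 ⟨v, rfl⟩
    refine ⟨Z ⊞ Q, P, biprod.desc ι q, π ≫ biprod.fst, hP, ⟨fun x => ?_, fun x v => ⟨fun h => ?_,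
      ?_⟩, fun x v => ?_⟩, hZ.biprod hQ⟩
    · refine (injective_iff_map_eq_zero _).2 fun v h => ?_
      rw [appL_desc] at h
      have h1 : appL biprod.snd x v = 0 := by
        simpa [hι, hq] using congrArg (fun u => appL biprod.snd x (appL π x u)) h
      rw [h1, map_zero, add_zero, map_eq_zero_iff _ (hS.inj x)] at h
      exact appL_biprod_ext (by simp [h]) (by simp [h1])
    · have h1 : appL π x (v - appL q x (appL biprod.snd x (appL π x v))) = 0 :=
        appL_biprod_ext (by simpa [hq] using h) (by simp [hq])
      obtain ⟨u, hu⟩ := (hS.exact x _).1 h1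
      exact ⟨appL biprod.inl x u + appL biprod.inr x (appL biprod.snd x (appL π x v)), by
        simp [appL_desc, hu]⟩
    · rintro ⟨u, rfl⟩
      simp [appL_desc, hι, hq]
    · obtain ⟨u, hu⟩ := hS.surj x (appL biprod.inl x v)
      exact ⟨u, by simp [hu]⟩

/-- Schanuel's lemma: having a resolution does not depend on the first cover. -/
theorem HasRes.syzygy {m : ℕ} {F Z P : J ⥤ ModuleCat.{w} K} (h : HasRes (m + 1) F) {ι : Z ⟶ P}
    {π : P ⟶ F} (hP : IsFree P) (hS : IsSES ι π) : HasRes m Z := by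
  obtain ⟨Z', P', ι', π', hP', hS', hZ'⟩ := h
  obtain ⟨a, ha⟩ := hP.exists_lift π' hS'.surj π
  obtain ⟨b, hb⟩ := hP'.exists_lift π hS.surj π'
  have hι : ∀ x v, appL π x (appL ι x v) = 0 := fun x v => (hS.exact x _).2 ⟨v, rfl⟩
  have hι' : ∀ x v, appL π' x (appL ι' x v) = 0 := fun x v => (hS'.exact x _).2 ⟨v, rfl⟩
  -- First component of an isomorphism from `Z' ⊞ P` to `Z ⊞ P'`. The second component is `ι' + a`;
  -- subtracting its image under `b` from the `P`-coordinate leaves an element killed by `π`, hence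
  -- one of `Z`.
  obtain ⟨k, hk⟩ := hS.exists_lift (biprod.snd - biprod.desc ι' a ≫ b) fun x v => by
    simp [appL_desc, hb, ha, hι']
  refine HasRes.of_biprod (Q := P') ((hZ'.biprod hP).of_bijective
    (biprod.lift k (biprod.desc ι' a)) fun x => ⟨?_, fun v => ?_⟩) hP'
  · refine (injective_iff_map_eq_zero _).2 fun v h => ?_
    have h1 : appL k x v = 0 := by simpa using congrArg (appL biprod.fst x) h
    have h2 : appL (biprod.desc ι' a) x v = 0 := by simpa using congrArg (appL biprod.snd x) h
    have h3 : appL biprod.snd x v = 0 := by simpa [h1, h2] using (hk x v).symm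
    rw [appL_desc, h3, map_zero, add_zero, map_eq_zero_iff _ (hS'.inj x)] at h2
    exact appL_biprod_ext (by simp [h2]) (by simp [h3])
  · obtain ⟨z, hz⟩ : ∃ z, z = appL biprod.fst x v := ⟨_, rfl⟩
    obtain ⟨p, hp⟩ : ∃ p, p = appL biprod.snd x v := ⟨_, rfl⟩
    -- The preimage of `(z, p)` has `P`-coordinate `ι z + b p`; its `Z'`-coordinate `u` is what is
    -- missing to reach `p`.
    obtain ⟨u, hu⟩ := (hS'.exact x (p - appL a x (appL ι x z + appL b x p))).1 (by
      simp [ha, hb, hι])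
    have h1 : appL (biprod.desc ι' a) x
        (appL biprod.inl x u + appL biprod.inr x (appL ι x z + appL b x p)) = p := by
      rw [appL_desc]
      simp only [map_add, appL_fst_inl, appL_fst_inr, appL_snd_inl, appL_snd_inr, hu]
      simp
    refine ⟨appL biprod.inl x u + appL biprod.inr x (appL ι x z + appL b x p),
      appL_biprod_ext ?_ ?_⟩
    · rw [appL_fst_lift, ← hz]
      apply hS.inj x
      rw [hk, appL_sub, appL_comp, h1]
      simp
    · rw [appL_snd_lift, h1, hp]

end Resolvability

/-! ### Minimality of a resolution as a radical condition -/

section MinimalResolutions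

variable {K : Type u} [Field K] {J : Type v} [PartialOrder J] {n : ℕ∞}
  {F : J ⥤ ModuleCat.{w} K}

namespace Resolution

variable (P : Resolution n F)

/-- The objects of the augmented complex of a resolution, with `F` in degree `0`. -/
def augX : ℕ → (J ⥤ ModuleCat.{w} K)
  | 0 => F
  | k + 1 => P.complex.X k

/-- The differentials of the augmented complex of a resolution. -/
def augD : ∀ k : ℕ, P.complex.X k ⟶ P.augX k
  | 0 => P.aug
  | k + 1 => P.complex.d (k + 1) k

theorem augD_comp : ∀ k : ℕ, P.complex.d (k + 1) k ≫ P.augD k = 0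
  | 0 => P.d_aug
  | k + 1 => P.complex.d_comp_d (k + 2) (k + 1) k

theorem appL_augD_comp (k : ℕ) (x : J) (v : (P.complex.X (k + 1)).obj x) :
    appL (P.augD k) x (appL (P.complex.d (k + 1) k) x v) = 0 := by
  rw [← appL_comp, augD_comp, appL_zero]

theorem augD_zero_surjective (hn : 0 < n) (x : J) : Function.Surjective (appL (P.augD 0) x) :=
  (epi_iff_surjective_appL _).1 (P.epi hn) x

theorem augD_exact : ∀ k : ℕ, ((k + 1 : ℕ) : ℕ∞) < n → ∀ x (v : (P.complex.X k).obj x),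
    appL (P.augD k) x v = 0 → ∃ u, appL (P.complex.d (k + 1) k) x u = v
  | 0, hk, x, v, hv => exact_iff_appL.1 (P.exact_zero (by simpa using hk)) x v hv
  | k + 1, hk, x, v, hv => by
    have h := P.exact_succ k hk
    rw [P.complex.exactAt_iff' (k + 2) (k + 1) k (by simp) (by simp)] at h
    exact exact_iff_appL.1 h x v hv

theorem isSES_zero (hn : 0 < n) : IsSES (kernel.ι (P.augD 0)) (P.augD 0) :=
  isSES_kernel _ (P.augD_zero_surjective hn)

/-- The map onto the kernel of a differential. -/
noncomputable def toKernel (k : ℕ) : P.complex.X (k + 1) ⟶ kernel (P.augD k) :=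
  kernel.lift _ (P.complex.d (k + 1) k) (P.augD_comp k)

theorem appL_toKernel (k : ℕ) (x : J) (v : (P.complex.X (k + 1)).obj x) :
    appL (kernel.ι (P.augD k)) x (appL (P.toKernel k) x v) = appL (P.complex.d (k + 1) k) x v := by
  rw [← appL_comp, toKernel, kernel.lift_ι]

theorem toKernel_surjective (k : ℕ) (hk : ((k + 1 : ℕ) : ℕ∞) < n) (x : J) :
    Function.Surjective (appL (P.toKernel k) x) := by
  intro v
  obtain ⟨u, hu⟩ := P.augD_exact k hk x _ ((appL_eq_zero_iff_kernel _ _ _).2 ⟨v, rfl⟩)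
  exact ⟨u, appL_kernel_ι_injective _ x (by rw [appL_toKernel, hu])⟩

theorem isSES_succ (k : ℕ) (hk : ((k + 1 : ℕ) : ℕ∞) < n) :
    IsSES (kernel.ι (P.augD (k + 1))) (P.toKernel k) where
  inj := appL_kernel_ι_injective _
  exact x v := by
    rw [← appL_eq_zero_iff_kernel, ← map_eq_zero_iff _ (appL_kernel_ι_injective (P.augD k) x),
      appL_toKernel]
    rfl
  surj := P.toKernel_surjective k hk

/-- The terms `P_{k+1}, …, P_{k+m}` resolve the kernel at `P_k`, which is why `k + 1 + m ≤ n` is the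
bound. -/
theorem hasRes_kernel (m : ℕ) : ∀ k : ℕ, ((k + 1 + m : ℕ) : ℕ∞) ≤ n →
    HasRes m (kernel (P.augD k)) := by
  induction m with
  | zero => exact fun _ _ => trivial
  | succ m ih =>
    intro k hk
    have hk' : ((k + 1 : ℕ) : ℕ∞) < n :=
      lt_of_lt_of_le (Nat.cast_lt.2 (by omega)) hk
    exact ⟨_, _, _, _, P.free _ hk', P.isSES_succ k hk', ih (k + 1) (by convert hk using 2; ring)⟩

include P in
theorem hasRes (m : ℕ) (hm : (m : ℕ∞) ≤ n) : HasRes m F := by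
  cases m with
  | zero => trivial
  | succ m =>
    have hn : 0 < n := lt_of_lt_of_le (by simp) hm
    exact ⟨_, _, _, _, P.free 0 hn, P.isSES_zero hn,
      P.hasRes_kernel m 0 (by convert hm using 2; ring)⟩

/-- The kernels of all differentials of a resolution are contained in the radicals. -/
def RadMinimal : Prop :=
  ∀ k : ℕ, (k : ℕ∞) < n → KerLeRad (P.augD k)

variable {P}

/-- The image of `φ` and the kernel of `π` together span `Q`. The kernel is in the radical, so `φ`
is onto by Nakayama, and injective because values are finite dimensional. -/
theorem bijective_of_kerLeRad {Q : J ⥤ ModuleCat.{w} K} (hQ : IsFree Q) (φ : Q ⟶ Q)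
    {G : J ⥤ ModuleCat.{w} K} {π : Q ⟶ G} (hπ : KerLeRad π)
    (h : ∀ x v, ∃ u, appL π x (appL φ x u) = appL π x v) (x : J) :
    Function.Bijective (appL φ x) := by
  obtain ⟨m, g, ⟨B⟩⟩ := hQ.exists_freeBasis
  have hs : Function.Surjective (appL φ x) := by
    rw [← LinearMap.range_eq_top]
    refine B.nakayama (fun x => LinearMap.range (appL φ x)) ?_ ?_ x
    · rintro x y hxy _ ⟨v, rfl⟩
      exact ⟨res Q hxy v, appL_res φ hxy v⟩
    · intro x
      rw [eq_top_iff]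
      intro v _
      obtain ⟨u, hu⟩ := h x v
      rw [← sub_add_cancel v (appL φ x u), add_comm]
      exact Submodule.add_mem_sup ⟨u, rfl⟩ (hπ x _ (by rw [map_sub, hu, sub_self]))
  have := B.module_finite x
  exact ⟨LinearMap.injective_iff_surjective.2 hs, hs⟩

theorem RadMinimal.isMinimal (hP : P.RadMinimal) : P.IsMinimal := by
  intro φ hφ
  have key : ∀ k x, Function.Bijective (appL (φ.f k) x) := by
    intro k
    induction k using Nat.strong_induction_on with
    | _ k ih =>
    by_cases hk : (k : ℕ∞) < n
    · refine bijective_of_kerLeRad (P.free k hk) _ (hP k hk) fun x v => ?_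
      cases k with
      | zero => exact ⟨v, by rw [← appL_comp]; exact congrArg (appL · x v) hφ⟩
      | succ k =>
        have hcomm : ∀ u, appL (P.complex.d (k + 1) k) x (appL (φ.f (k + 1)) x u) =
            appL (φ.f k) x (appL (P.complex.d (k + 1) k) x u) := fun u => by
          rw [← appL_comp, ← appL_comp, φ.comm]
        -- The preimage `t` of the boundary of `v` is again a cycle, by the injectivity one degree
        -- lower or the compatibility with the augmentation, hence a boundary `d u`; then `φ u` and
        -- `v` have equal boundaries.
        obtain ⟨t, ht⟩ := (ih k k.lt_succ_self x).2 (appL (P.complex.d (k + 1) k) x v)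
        obtain ⟨u, hu⟩ := P.augD_exact k hk x t (by
          cases k with
          | zero =>
            have h1 : appL P.aug x (appL (φ.f 0) x t) = appL P.aug x t := by
              rw [← appL_comp, hφ]
            exact h1.symm.trans ((congrArg _ ht).trans (P.appL_augD_comp 0 x v))
          | succ k =>
            apply (ih k (by omega) x).1
            have h1 : appL (φ.f k) x (appL (P.complex.d (k + 1) k) x t) =
                appL (P.complex.d (k + 1) k) x (appL (φ.f (k + 1)) x t) := by
              rw [← appL_comp, ← appL_comp, φ.comm]
            exact (h1.trans ((congrArg _ ht).trans (P.appL_augD_comp (k + 1) x v))).trans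
              (map_zero _).symm)
        exact ⟨u, (hcomm u).trans (by rw [hu, ht]; rfl)⟩
    · intro x
      have : Subsingleton ((P.complex.X k).obj x) :=
        ModuleCat.isZero_iff_subsingleton.1 ((Functor.isZero_iff _).1 (P.isZero k (not_lt.1 hk)) x)
      exact ⟨fun _ _ _ => Subsingleton.elim _ _, fun v => ⟨v, Subsingleton.elim _ _⟩⟩
  have := fun k => isIso_of_bijective (φ.f k) (key k)
  exact HomologicalComplex.Hom.isIso_of_components φ

end Resolution

/-- Off the radical, `z` has a non-zero coefficient at a generator of degree `x`. Sending that
generator to the suitable multiple of `v` and all others to zero does it. -/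
theorem FreeBasis.exists_map_of_notMem_rad {P : J ⥤ ModuleCat.{w} K} {κ : Type*} {g : κ → J}
    (B : FreeBasis P g) {x : J} {z : P.obj x} (hz : z ∉ rad P x) (G : J ⥤ ModuleCat.{w} K)
    (v : G.obj x) : ∃ s : P ⟶ G, appL s x z = v := by
  classical
  rw [B.mem_rad_iff] at hz
  push Not at hz
  obtain ⟨⟨k, hk⟩, (rfl : g k = x), hc⟩ := hz
  refine ⟨B.lift fun l => if h : l = k then
    ((B.b (g k)).repr z ⟨k, hk⟩)⁻¹ • res G (h ▸ le_rfl) v else 0, ?_⟩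
  refine (congrArg (appL _ (g k)) ((B.b (g k)).linearCombination_repr z)).symm.trans ?_
  rw [Finsupp.apply_linearCombination, Finsupp.linearCombination_apply,
    Finsupp.sum_eq_single (⟨k, hk⟩ : {l // g l ≤ g k})]
  · simp [smul_smul, hc]
  · rintro ⟨l, hl⟩ _ hlk
    have : l ≠ k := fun h => hlk (Subtype.ext h)
    simp [this]
  · simp

namespace Resolution

variable {P : Resolution n F}

/-- The endomorphism `1 - χ` lies over `F`, so it is invertible, yet it kills every fixed point of
`χ`. -/
theorem IsMinimal.map_eq_zero (hP : P.IsMinimal) {χ : P.complex ⟶ P.complex}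
    (hχ : χ.f 0 ≫ P.aug = 0) {k : ℕ} {x : J} {z : (P.complex.X k).obj x}
    (hz : appL (χ.f k) x z = z) : z = 0 := by
  have := hP (𝟙 _ - χ) (by simp [hχ])
  apply (bijective_of_isIso ((𝟙 P.complex - χ).f k) x).1
  rw [HomologicalComplex.sub_f_apply, HomologicalComplex.id_f, appL_sub, hz, map_zero]
  exact sub_self z

/-- A kernel element `z` outside the radical is made a fixed point of an endomorphism inducing zero
on `F`. Below the last degree `z = d y`, and a homotopy sending `z` to `y` gives a null-homotopic
such map. In the last degree there is no `y`, but a map through the kernel, concentrated in degree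
`k`, already commutes with the differentials. -/
theorem IsMinimal.radMinimal (hP : P.IsMinimal) : P.RadMinimal := by
  intro k hk x z hz
  by_contra hrad
  obtain ⟨m, g, ⟨B⟩⟩ := (P.free k hk).exists_freeBasis
  suffices hz0 : z = 0 from hrad (hz0 ▸ Submodule.zero_mem _)
  by_cases hk1 : ((k + 1 : ℕ) : ℕ∞) < n
  · obtain ⟨y, rfl⟩ := P.augD_exact k hk1 x z hz
    obtain ⟨s, hs⟩ := B.exists_map_of_notMem_rad hrad (P.complex.X (k + 1)) y
    let t : ∀ i, P.complex.X i ⟶ P.complex.X (i + 1) := Function.update (fun _ => 0) k s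
    let h : ∀ i j, (ComplexShape.down ℕ).Rel j i → (P.complex.X i ⟶ P.complex.X j) :=
      fun i j hij => t i ≫ eqToHom (congrArg P.complex.X hij)
    have ht : ∀ i (hi : (ComplexShape.down ℕ).Rel (i + 1) i), h i (i + 1) hi = t i := fun i hi => by
      simp [h]
    refine hP.map_eq_zero (χ := Homotopy.nullHomotopicMap' h) ?_ (k := k) ?_
    · rw [Homotopy.nullHomotopicMap'_f_of_not_rel_left (k₁ := 1) (k₀ := 0) (by simp) (by simp),
        ht 0 rfl, Category.assoc, P.d_aug, comp_zero]
    · have htk : t k = s := Function.update_self ..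
      cases k with
      | zero =>
        rw [Homotopy.nullHomotopicMap'_f_of_not_rel_left (k₁ := 1) (k₀ := 0) (by simp) (by simp),
          ht 0 rfl, htk, appL_comp, hs]
      | succ k =>
        rw [Homotopy.nullHomotopicMap'_f (k₂ := k + 2) (k₁ := k + 1) (k₀ := k) (by simp) (by simp),
          ht k rfl, ht (k + 1) rfl, htk, appL_add, appL_comp, appL_comp, hs]
        have : appL (P.complex.d (k + 1) k) x (appL (P.complex.d (k + 1 + 1) (k + 1)) x y) = 0 := hz
        rw [this, map_zero, zero_add]
  · obtain ⟨y, rfl⟩ := (appL_eq_zero_iff_kernel _ _ _).1 hz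
    obtain ⟨s, hs⟩ := B.exists_map_of_notMem_rad hrad _ y
    have hd : P.complex.d (k + 1) k = 0 := (P.isZero (k + 1) (not_lt.1 hk1)).eq_of_src _ _
    let t : ∀ i, P.complex.X i ⟶ P.complex.X i :=
      Function.update (fun _ => 0) k (s ≫ kernel.ι (P.augD k))
    have htk : t k = s ≫ kernel.ι (P.augD k) := Function.update_self ..
    have ht : ∀ i, i ≠ k → t i = 0 := fun i hi => Function.update_of_ne hi _ _
    have hcond : ∀ i, i + 1 = k → (s ≫ kernel.ι (P.augD k)) ≫ P.complex.d k i = 0 := by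
      rintro i rfl
      rw [Category.assoc]
      exact (congrArg (s ≫ ·) (kernel.condition (P.augD (i + 1)))).trans comp_zero
    refine hP.map_eq_zero (χ := { f := t, comm' := ?_ }) ?_ (k := k) ?_
    · rintro i j (hij : j + 1 = i)
      have h1 : P.complex.d i j ≫ t j = 0 := by
        by_cases hj : j = k
        · subst hj hij
          rw [hd, zero_comp]
        · rw [ht j hj, comp_zero]
      rw [h1]
      by_cases hi : i = k
      · subst hi
        rw [htk, hcond j hij]
      · rw [ht i hi, zero_comp]
    · dsimp only
      by_cases h0 : k = 0
      · subst h0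
        rw [htk, Category.assoc]
        exact (congrArg (s ≫ ·) (kernel.condition (P.augD 0))).trans comp_zero
      · rw [ht 0 (Ne.symm h0), zero_comp]
    · dsimp only
      rw [htk, appL_comp, hs]

end Resolution

end MinimalResolutions

/-! ### Existence of minimal resolutions -/

section Existence

variable {K : Type u} [Field K] {J : Type v} [PartialOrder J]

/-- Totality in `F` and `p` lets the syzygies be defined by plain recursion. The proposition `p`
will be `k < n`, so the complex vanishes from degree `n` on; when `p` holds without a cover, the
zero functor is a mere placeholder. -/
theorem exists_cover (p : Prop) (F : J ⥤ ModuleCat.{w} K) :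
    ∃ (Q : J ⥤ ModuleCat.{w} K) (ρ : Q ⟶ F),
      (p → HasRes 1 F → IsFree Q ∧ (∀ x, Function.Surjective (appL ρ x)) ∧ KerLeRad ρ) ∧
      (¬ p → IsZero Q) := by
  by_cases h : p ∧ HasRes 1 F
  · obtain ⟨hp, Z, P, ι, π, hP, hS, -⟩ := h
    have := (epi_iff_surjective_appL π).2 hS.surj
    obtain ⟨Q, ρ, hQ, hρ, hrad⟩ := exists_minimal_cover hP π
    exact ⟨Q, ρ, fun _ _ => ⟨hQ, (epi_iff_surjective_appL ρ).1 hρ, hrad⟩, fun h => absurd hp h⟩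
  · obtain ⟨Z, hZ⟩ := HasZeroObject.zero (C := J ⥤ ModuleCat.{w} K)
    exact ⟨Z, 0, fun hp hF => absurd ⟨hp, hF⟩ h, fun _ => hZ⟩

/-- A minimal cover of `F` if `p` holds, and zero otherwise. -/
noncomputable def cover (p : Prop) (F : J ⥤ ModuleCat.{w} K) : J ⥤ ModuleCat.{w} K :=
  (exists_cover p F).choose

/-- The map from the minimal cover. -/
noncomputable def coverπ (p : Prop) (F : J ⥤ ModuleCat.{w} K) : cover p F ⟶ F :=
  (exists_cover p F).choose_spec.choose

theorem cover_spec {p : Prop} {F : J ⥤ ModuleCat.{w} K} (hp : p) (hF : HasRes 1 F) :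
    IsFree (cover p F) ∧ (∀ x, Function.Surjective (appL (coverπ p F) x)) ∧
      KerLeRad (coverπ p F) :=
  (exists_cover p F).choose_spec.choose_spec.1 hp hF

theorem isZero_cover {p : Prop} (hp : ¬ p) (F : J ⥤ ModuleCat.{w} K) : IsZero (cover p F) :=
  (exists_cover p F).choose_spec.choose_spec.2 hp

theorem HasRes.mono {F : J ⥤ ModuleCat.{w} K} {l m : ℕ} (hlm : l ≤ m) (h : HasRes m F) :
    HasRes l F := by
  induction m generalizing l F with
  | zero =>
    obtain rfl : l = 0 := by omega
    trivial
  | succ m ih =>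
    cases l with
    | zero => trivial
    | succ l =>
      obtain ⟨Z, P, ι, π, hP, hS, hZ⟩ := h
      exact ⟨Z, P, ι, π, hP, hS, ih (by omega) hZ⟩

variable (n : ℕ∞) (F : J ⥤ ModuleCat.{w} K)

/-- The iterated syzygies of `F`, cut off at `n`. -/
noncomputable def syz : ℕ → (J ⥤ ModuleCat.{w} K)
  | 0 => F
  | k + 1 => kernel (coverπ ((k : ℕ∞) < n) (syz k))

/-- The terms of the minimal resolution of `F`. -/
noncomputable abbrev minX (k : ℕ) : J ⥤ ModuleCat.{w} K := cover ((k : ℕ∞) < n) (syz n F k)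

/-- The map from a term of the minimal resolution onto the syzygy. -/
noncomputable abbrev minπ (k : ℕ) : minX n F k ⟶ syz n F k := coverπ ((k : ℕ∞) < n) (syz n F k)

/-- The inclusion of a syzygy. -/
noncomputable def syzι (k : ℕ) : syz n F (k + 1) ⟶ minX n F k :=
  kernel.ι (coverπ ((k : ℕ∞) < n) (syz n F k))

theorem syzι_minπ (k : ℕ) : syzι n F k ≫ minπ n F k = 0 := kernel.condition _

theorem syzι_injective (k : ℕ) (x : J) : Function.Injective (appL (syzι n F k) x) :=
  appL_kernel_ι_injective _ x

/-- The differentials of the minimal resolution of `F`. -/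
noncomputable def minD (k : ℕ) : minX n F (k + 1) ⟶ minX n F k :=
  minπ n F (k + 1) ≫ syzι n F k

theorem minD_minπ (k : ℕ) : minD n F k ≫ minπ n F k = 0 := by
  rw [minD, Category.assoc, syzι_minπ, comp_zero]

theorem minD_comp (k : ℕ) : minD n F (k + 1) ≫ minD n F k = 0 := by
  rw [minD, minD, Category.assoc, ← Category.assoc (syzι n F (k + 1)), syzι_minπ, zero_comp,
    comp_zero]

theorem appL_minD_eq_zero {k : ℕ} {x : J} {v : (minX n F (k + 1)).obj x}
    (h : appL (minD n F k) x v = 0) : appL (minπ n F (k + 1)) x v = 0 :=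
  syzι_injective n F k x (by rw [map_zero]; exact h)

variable {n F}

/-- Each passage to a syzygy costs one step of resolvability, by Schanuel's lemma. Quantifying over
finite lengths treats `n = ∞` uniformly. -/
theorem hasRes_syz (hF : ∀ m : ℕ, (m : ℕ∞) ≤ n → HasRes m F) (k : ℕ) :
    ∀ m : ℕ, ((k + m : ℕ) : ℕ∞) ≤ n → HasRes m (syz n F k) := by
  induction k with
  | zero => exact fun m hm => hF m (by simpa using hm)
  | succ k ih =>
    intro m hm
    have hk : (k : ℕ∞) < n := lt_of_lt_of_le (Nat.cast_lt.2 (by omega)) hm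
    have h := ih (m + 1) (by convert hm using 2; ring)
    obtain ⟨h1, h2, -⟩ := cover_spec hk (h.mono (by omega))
    exact h.syzygy h1 (isSES_kernel _ h2)

theorem minX_spec (hF : ∀ m : ℕ, (m : ℕ∞) ≤ n → HasRes m F) {k : ℕ} (hk : (k : ℕ∞) < n) :
    IsFree (minX n F k) ∧ (∀ x, Function.Surjective (appL (minπ n F k) x)) ∧
      KerLeRad (minπ n F k) :=
  cover_spec hk (hasRes_syz hF k 1 (by exact_mod_cast Order.add_one_le_of_lt hk))

theorem exists_of_appL_minπ_eq_zero (hF : ∀ m : ℕ, (m : ℕ∞) ≤ n → HasRes m F) {k : ℕ}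
    (hk : ((k + 1 : ℕ) : ℕ∞) < n) {x : J} {v : (minX n F k).obj x}
    (hv : appL (minπ n F k) x v = 0) : ∃ u, appL (minD n F k) x u = v := by
  obtain ⟨t, rfl⟩ := (appL_eq_zero_iff_kernel _ _ _).1 hv
  obtain ⟨u, rfl⟩ := (minX_spec hF hk).2.1 x t
  exact ⟨u, rfl⟩

variable (n F) in
/-- The complex underlying the minimal resolution of `F`. -/
noncomputable def minComplex : ChainComplex (J ⥤ ModuleCat.{w} K) ℕ :=
  ChainComplex.of (minX n F) (minD n F) (minD_comp n F)

theorem minComplex_d (k : ℕ) : (minComplex n F).d (k + 1) k = minD n F k :=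
  ChainComplex.of_d (minX n F) (minD n F) k

/-- The minimal resolution of `F`. -/
noncomputable def minRes (hF : ∀ m : ℕ, (m : ℕ∞) ≤ n → HasRes m F) : Resolution n F where
  complex := minComplex n F
  aug := minπ n F 0
  d_aug := (congrArg (· ≫ minπ n F 0) (minComplex_d 0)).trans (minD_minπ n F 0)
  free i hi := (minX_spec hF hi).1
  isZero i hi := isZero_cover (not_lt.2 hi) _
  epi hn := (epi_iff_surjective_appL _).2 (minX_spec hF hn).2.1
  exact_zero hn := by
    rw [exact_iff_appL]
    intro x v hv
    obtain ⟨u, hu⟩ := exists_of_appL_minπ_eq_zero hF (k := 0) (by simpa using hn) hv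
    exact ⟨u, (congrArg (fun f => appL f x u) (minComplex_d 0)).trans hu⟩
  exact_succ i hi := by
    rw [HomologicalComplex.exactAt_iff' _ (i + 2) (i + 1) i (by simp) (by simp), exact_iff_appL]
    intro x v hv
    have hv' : appL ((minComplex n F).d (i + 1) i) x v = 0 := hv
    rw [minComplex_d] at hv'
    obtain ⟨u, hu⟩ := exists_of_appL_minπ_eq_zero hF hi (appL_minD_eq_zero n F hv')
    refine ⟨u, (?_ : appL ((minComplex n F).d (i + 1 + 1) (i + 1)) x u = v)⟩
    rw [minComplex_d]
    exact hu

theorem minRes_radMinimal (hF : ∀ m : ℕ, (m : ℕ∞) ≤ n → HasRes m F) : (minRes hF).RadMinimal := by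
  rintro (_ | k) hk x v hv
  · exact (minX_spec hF hk).2.2 x v hv
  · refine (minX_spec hF hk).2.2 x v (appL_minD_eq_zero n F ?_)
    have hv' : appL ((minComplex n F).d (k + 1) k) x v = 0 := hv
    rwa [minComplex_d] at hv'

/-- A resolvable functor has Betti diagrams. -/
theorem IsResolvable.exists_areBettiDiagrams (h : IsResolvable n F) :
    ∃ β : ℕ → J → ModuleCat.{w} K, AreBettiDiagrams n F β := by
  classical
  obtain ⟨R⟩ := h
  let P : Resolution n F := minRes R.hasRes
  have hex : ∀ i : ℕ, ∃ W : J → ModuleCat.{w} K, (i : ℕ∞) < n → HasBettiDiagram (P.complex.X i) W := by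
    intro i
    by_cases hi : (i : ℕ∞) < n
    · exact (P.free i hi).imp fun W hW _ => hW
    -- Nothing is required in degrees `≥ n`; the value is arbitrary.
    · exact ⟨fun _ => ModuleCat.of K PUnit, fun h => absurd h hi⟩
  choose β hβ using hex
  exact ⟨β, P, (minRes_radMinimal R.hasRes).isMinimal, hβ⟩

end Existence

/-! ### Functoriality and right exactness of Koszul complexes -/

section KoszulFunctor

variable {K : Type u} [Field K] {J : Type v} [PartialOrder J] [Finite J]

section BelowColim

variable {G H : J ⥤ ModuleCat.{w} K} {a : J}

/-- The canonical map `G(y) → colim_{⋂_{s ∈ S} (J ≤ s)} G` as a linear map. -/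
noncomputable def colimι (G : J ⥤ ModuleCat.{w} K) {S : Finset (Parent a)} (y : Below S) :
    G.obj y.1 →ₗ[K] belowColim G S :=
  (belowColimι G y).hom

theorem colimι_res {S : Finset (Parent a)} {y y' : Below S} (h : y ≤ y') (v : G.obj y.1) :
    colimι G y' (res G h v) = colimι G y v :=
  congrArg (fun f : G.obj y.1 ⟶ belowColim G S => f.hom v)
    (colimit.w (belowIncl S ⋙ G) (homOfLE h))

theorem belowColim_eq_top {S : Finset (Parent a)} {N : Submodule K (belowColim G S)}
    (h : ∀ y v, colimι G y v ∈ N) : N = ⊤ := by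
  have : ModuleCat.ofHom N.mkQ = 0 := belowColim_hom_ext G fun y => by
    ext v
    exact (Submodule.Quotient.mk_eq_zero N).2 (h y v)
  rw [← N.ker_mkQ]
  exact LinearMap.ker_eq_top.2 (congrArg ModuleCat.Hom.hom this)

theorem colimι_map {S T : Finset (Parent a)} (h : T ⊆ S) (y : Below S) (v : G.obj y.1) :
    (belowColimMap G h).hom (colimι G y v) =
      colimι G (⟨y.1, fun s hs => y.2 s (h hs)⟩ : Below T) v :=
  congrArg (fun f : G.obj y.1 ⟶ belowColim G T => f.hom v) (belowColimι_map G h y)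

theorem colimι_desc {S : Finset (Parent a)} (hS : S.Nonempty) (y : Below S) (v : G.obj y.1) :
    (belowColimDesc G hS).hom (colimι G y v) = res G (Below.le hS y) v :=
  congrArg (fun f : G.obj y.1 ⟶ G.obj a => f.hom v) (belowColimι_desc G hS y)

/-- The functor `G ↦ colim_{⋂_{s ∈ S} (J ≤ s)} G`. -/
noncomputable def belowColimFunctor (K : Type u) [Field K] (S : Finset (Parent a)) :
    (J ⥤ ModuleCat.{w} K) ⥤ ModuleCat.{w} K :=
  (Functor.whiskeringLeft (Below S) J (ModuleCat.{w} K)).obj (belowIncl S) ⋙ colim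

/-- Functoriality of `belowColim`. -/
noncomputable def belowColimNat (φ : G ⟶ H) (S : Finset (Parent a)) :
    belowColim G S ⟶ belowColim H S :=
  (belowColimFunctor K S).map φ

theorem colimι_nat (φ : G ⟶ H) {S : Finset (Parent a)} (y : Below S) (v : G.obj y.1) :
    (belowColimNat φ S).hom (colimι G y v) = colimι H y (appL φ y.1 v) :=
  congrArg (fun f : G.obj y.1 ⟶ belowColim H S => f.hom v)
    (ι_colimMap (Functor.whiskerLeft (belowIncl S) φ) y)

theorem belowColimι_nat (φ : G ⟶ H) {S : Finset (Parent a)} (y : Below S) :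
    belowColimι G y ≫ belowColimNat φ S = φ.app y.1 ≫ belowColimι H y :=
  ι_colimMap (Functor.whiskerLeft (belowIncl S) φ) y

theorem belowColimMap_nat (φ : G ⟶ H) {S T : Finset (Parent a)} (h : T ⊆ S) :
    belowColimMap G h ≫ belowColimNat φ T = belowColimNat φ S ≫ belowColimMap H h := by
  apply belowColim_hom_ext
  intro y
  rw [← Category.assoc, belowColimι_map, belowColimι_nat, ← Category.assoc, belowColimι_nat,
    Category.assoc, belowColimι_map]

theorem belowColimDesc_nat (φ : G ⟶ H) {S : Finset (Parent a)} (hS : S.Nonempty) :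
    belowColimDesc G hS ≫ φ.app a = belowColimNat φ S ≫ belowColimDesc H hS := by
  apply belowColim_hom_ext
  intro y
  rw [← Category.assoc, belowColimι_desc, ← Category.assoc, belowColimι_nat,
    Category.assoc, belowColimι_desc, φ.naturality]

variable {Z P F : J ⥤ ModuleCat.{w} K} {ι : Z ⟶ P} {π : P ⟶ F}

/-- Restriction followed by the colimit preserves cokernels. Left exactness can fail, which is the
obstruction to comparing Betti diagrams with Koszul homology in general. -/
theorem IsSES.belowColim_exact (h : IsSES ι π) (S : Finset (Parent a)) (v : belowColim P S)
    (hv : (belowColimNat π S).hom v = 0) : ∃ u, (belowColimNat ι S).hom u = v := by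
  have : Epi π := (epi_iff_surjective_appL π).2 h.surj
  have hex : (ShortComplex.mk ι π h.comp_eq_zero).Exact :=
    exact_iff_appL.2 fun x v hv => (h.exact x v).1 hv
  have : PreservesColimitsOfSize.{0, 0} (belowColimFunctor.{u, v, w} K S) := by
    unfold belowColimFunctor
    infer_instance
  have : (belowColimFunctor.{u, v, w} K S).PreservesZeroMorphisms := by
    unfold belowColimFunctor
    infer_instance
  exact (ShortComplex.moduleCat_exact_iff _).1
    (hex.map_of_epi_of_preservesCokernel (belowColimFunctor K S) ‹_› inferInstance) v hv

theorem IsSES.belowColim_surjective (h : IsSES ι π) (S : Finset (Parent a)) :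
    Function.Surjective (belowColimNat π S).hom := by
  rw [← LinearMap.range_eq_top]
  refine belowColim_eq_top fun y v => ?_
  obtain ⟨u, rfl⟩ := h.surj y.1 v
  exact ⟨_, colimι_nat π y u⟩

/-- If the indexing poset has a greatest element, then the colimit is the value there. -/
theorem colimι_bijective {S : Finset (Parent a)} {y : Below S} (hy : ∀ y', y' ≤ y) :
    Function.Bijective (colimι G y) :=
  (ConcreteCategory.isIso_iff_bijective (belowColimι G y)).1
    (isIso_ι_of_isTerminal (IsTerminal.ofUniqueHom (fun y' => homOfLE (hy y')) fun _ _ => rfl)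
      (belowIncl S ⋙ G))

/-- With a greatest element `y` the colimit is evaluation at `y`, which is exact. -/
theorem IsSES.belowColim_injective (h : IsSES ι π) {S : Finset (Parent a)} {y : Below S}
    (hy : ∀ y', y' ≤ y) : Function.Injective (belowColimNat ι S).hom := by
  intro u u' huu
  obtain ⟨v, rfl⟩ := (colimι_bijective hy).2 u
  obtain ⟨v', rfl⟩ := (colimι_bijective hy).2 u'
  rw [colimι_nat, colimι_nat] at huu
  rw [h.inj y.1 ((colimι_bijective hy).1 huu)]

end BelowColim

section KoszulSum

variable {G H : J ⥤ ModuleCat.{w} K} {a : J}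

/-- Functoriality of `koszulSum`. -/
noncomputable def koszulSumNat (φ : G ⟶ H) (k : ℕ) : koszulSum G a k ⟶ koszulSum H a k :=
  koszulSumDesc G a fun S => belowColimNat φ S.1 ≫ koszulSumι H S

theorem koszulSumι_nat (φ : G ⟶ H) {k : ℕ} (S : KoszulIdx a k) :
    koszulSumι G S ≫ koszulSumNat φ k = belowColimNat φ S.1 ≫ koszulSumι H S :=
  koszulSumι_desc ..

/-- The projection onto a summand. -/
noncomputable def koszulSumPr (G : J ⥤ ModuleCat.{w} K) {k : ℕ} (S : KoszulIdx a k) :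
    koszulSum G a k ⟶ belowColim G S.1 :=
  biproduct.π (fun S : KoszulIdx a k => belowColim G S.1) S

theorem koszulSumι_pr_self {k : ℕ} (S : KoszulIdx a k) :
    koszulSumι G S ≫ koszulSumPr G S = 𝟙 _ :=
  biproduct.ι_π_self _ S

theorem koszulSumι_pr_ne {k : ℕ} {S T : KoszulIdx a k} (h : S ≠ T) :
    koszulSumι G S ≫ koszulSumPr G T = 0 :=
  biproduct.ι_π_ne _ h

theorem koszulSum_total {k : ℕ} [Fintype (KoszulIdx a k)] :
    ∑ S : KoszulIdx a k, koszulSumPr G S ≫ koszulSumι G S = 𝟙 _ := by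
  apply koszulSum_hom_ext
  intro T
  rw [Preadditive.comp_sum, Finset.sum_eq_single T, ← Category.assoc, koszulSumι_pr_self,
    Category.id_comp, Category.comp_id]
  · intro S _ hS
    rw [← Category.assoc, koszulSumι_pr_ne hS.symm, zero_comp]
  · simp

/-- The projection onto a summand, as a linear map. -/
noncomputable def koszulSumπ (G : J ⥤ ModuleCat.{w} K) {k : ℕ} (S : KoszulIdx a k) :
    koszulSum G a k →ₗ[K] belowColim G S.1 :=
  (koszulSumPr G S).hom

/-- The inclusion of a summand, as a linear map. -/
noncomputable def sumι (G : J ⥤ ModuleCat.{w} K) {k : ℕ} (S : KoszulIdx a k) :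
    belowColim G S.1 →ₗ[K] koszulSum G a k :=
  (koszulSumι G S).hom

theorem koszulSum_eq_top {k : ℕ} {N : Submodule K (koszulSum G a k)}
    (h : ∀ S v, sumι G S v ∈ N) : N = ⊤ := by
  have : ModuleCat.ofHom N.mkQ = 0 := koszulSum_hom_ext G a fun S => by
    ext v
    exact (Submodule.Quotient.mk_eq_zero N).2 (h S v)
  rw [← N.ker_mkQ]
  exact LinearMap.ker_eq_top.2 (congrArg ModuleCat.Hom.hom this)

theorem sumι_desc {k : ℕ} {M : ModuleCat.{w} K} (f : ∀ S : KoszulIdx a k, belowColim G S.1 ⟶ M)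
    (S : KoszulIdx a k) (v : belowColim G S.1) :
    (koszulSumDesc G a f).hom (sumι G S v) = (f S).hom v :=
  congrArg (fun f : belowColim G S.1 ⟶ M => f.hom v) (koszulSumι_desc G a f S)

theorem sumι_nat (φ : G ⟶ H) {k : ℕ} (S : KoszulIdx a k) (v : belowColim G S.1) :
    (koszulSumNat φ k).hom (sumι G S v) = sumι H S ((belowColimNat φ S.1).hom v) :=
  congrArg (fun f : belowColim G S.1 ⟶ koszulSum H a k => f.hom v) (koszulSumι_nat φ S)

theorem koszulSum_sum {k : ℕ} [Fintype (KoszulIdx a k)] (v : koszulSum G a k) :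
    ∑ S, sumι G S (koszulSumπ G S v) = v := by
  have h := congrArg (fun f : koszulSum G a k ⟶ koszulSum G a k => f.hom v)
    (koszulSum_total (G := G) (a := a) (k := k))
  simp only [ModuleCat.hom_sum, LinearMap.coe_sum, Finset.sum_apply] at h
  exact h

theorem koszulSumπ_nat (φ : G ⟶ H) {k : ℕ} (S : KoszulIdx a k) (v : koszulSum G a k) :
    koszulSumπ H S ((koszulSumNat φ k).hom v) = (belowColimNat φ S.1).hom (koszulSumπ G S v) := by
  have : koszulSumNat φ k ≫ koszulSumPr H S = koszulSumPr G S ≫ belowColimNat φ S.1 := by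
    apply koszulSum_hom_ext
    intro T
    rw [← Category.assoc, koszulSumι_nat, Category.assoc, ← Category.assoc (koszulSumι G T)]
    by_cases h : T = S
    · subst h
      rw [koszulSumι_pr_self, koszulSumι_pr_self, Category.id_comp, Category.comp_id]
    · rw [koszulSumι_pr_ne h, koszulSumι_pr_ne h, zero_comp, comp_zero]
  exact congrArg (fun f : koszulSum G a k ⟶ belowColim H S.1 => f.hom v) this

variable {Z P F : J ⥤ ModuleCat.{w} K} {ι : Z ⟶ P} {π : P ⟶ F}

theorem IsSES.koszulSum_surjective (h : IsSES ι π) (k : ℕ) :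
    Function.Surjective (koszulSumNat (a := a) π k).hom := by
  rw [← LinearMap.range_eq_top]
  refine koszulSum_eq_top fun S v => ?_
  obtain ⟨u, rfl⟩ := h.belowColim_surjective S.1 v
  exact ⟨_, sumι_nat π S u⟩

theorem IsSES.koszulSum_exact (h : IsSES ι π) {k : ℕ} (v : koszulSum P a k)
    (hv : (koszulSumNat π k).hom v = 0) : ∃ u, (koszulSumNat ι k).hom u = v := by
  have := Fintype.ofFinite (KoszulIdx a k)
  choose u hu using fun S : KoszulIdx a k => h.belowColim_exact S.1 (koszulSumπ P S v) (by
    rw [← koszulSumπ_nat, hv, map_zero])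
  refine ⟨∑ S, sumι Z S (u S), ?_⟩
  rw [map_sum]
  simp_rw [sumι_nat, hu, koszulSum_sum]

theorem IsSES.koszulSum_injective (h : IsSES ι π) {k : ℕ}
    (hk : ∀ S : KoszulIdx a k, ∃ y : Below S.1, ∀ y', y' ≤ y) :
    Function.Injective (koszulSumNat (a := a) ι k).hom := by
  have := Fintype.ofFinite (KoszulIdx a k)
  refine (injective_iff_map_eq_zero _).2 fun v hv => ?_
  rw [← koszulSum_sum v]
  refine Finset.sum_eq_zero fun S _ => ?_
  obtain ⟨y, hy⟩ := hk S
  have : koszulSumπ Z S v = 0 := h.belowColim_injective hy (by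
    rw [← koszulSumπ_nat, hv, map_zero, map_zero])
  rw [this, map_zero]

end KoszulSum

section KoszulMap

variable {G H : J ⥤ ModuleCat.{w} K} (a : J)

theorem koszulDZero_nat (φ : G ⟶ H) :
    koszulDZero G a ≫ φ.app a = koszulSumNat φ 1 ≫ koszulDZero H a := by
  apply koszulSum_hom_ext
  intro S
  rw [koszulDZero, koszulDZero, ← Category.assoc, koszulSumι_desc, ← Category.assoc,
    koszulSumι_nat, Category.assoc, koszulSumι_desc, belowColimDesc_nat]

/-- The terms of the map of Koszul complexes. -/
noncomputable def koszulXMap (φ : G ⟶ H) : ∀ k, koszulX G a k ⟶ koszulX H a k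
  | 0 => φ.app a
  | k + 1 => koszulSumNat φ (k + 1)

section

variable {a} {Z P F : J ⥤ ModuleCat.{w} K} {ι : Z ⟶ P} {π : P ⟶ F}

theorem IsSES.koszulXMap_surjective (h : IsSES ι π) :
    ∀ k, Function.Surjective (koszulXMap a π k).hom
  | 0 => h.surj a
  | k + 1 => h.koszulSum_surjective (k + 1)

theorem IsSES.koszulXMap_exact (h : IsSES ι π) : ∀ k (v : koszulX P a k),
    (koszulXMap a π k).hom v = 0 → ∃ u, (koszulXMap a ι k).hom u = v
  | 0, v => (h.exact a v).1
  | _ + 1, v => h.koszulSum_exact v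

theorem IsSES.koszulXMap_injective (h : IsSES ι π) : ∀ k,
    (∀ S : KoszulIdx a k, S.1.Nonempty → ∃ y : Below S.1, ∀ y', y' ≤ y) →
      Function.Injective (koszulXMap a ι k).hom
  | 0, _ => h.inj a
  | _ + 1, hk => h.koszulSum_injective fun S => hk S S.nonempty

end

variable [LinearOrder (Parent a)]

theorem koszulDSucc_nat (φ : G ⟶ H) (k : ℕ) :
    koszulDSucc G a k ≫ koszulSumNat φ k = koszulSumNat φ (k + 1) ≫ koszulDSucc H a k := by
  apply koszulSum_hom_ext
  intro S
  rw [koszulDSucc, koszulDSucc, ← Category.assoc, koszulSumι_desc, ← Category.assoc,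
    koszulSumι_nat, Category.assoc, koszulSumι_desc, Preadditive.sum_comp, Preadditive.comp_sum]
  refine Finset.sum_congr rfl fun s _ => ?_
  rw [Preadditive.zsmul_comp, Preadditive.comp_zsmul, Category.assoc, koszulSumι_nat,
    ← Category.assoc, ← Category.assoc, belowColimMap_nat]

theorem koszulXMap_comm (φ : G ⟶ H) : ∀ k,
    koszulXMap a φ (k + 1) ≫ koszulD H a k = koszulD G a k ≫ koszulXMap a φ k
  | 0 => (koszulDZero_nat a φ).symm
  | k + 1 => (koszulDSucc_nat a φ (k + 1)).symm

theorem koszulComplex_d (G : J ⥤ ModuleCat.{w} K) (k : ℕ) :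
    (koszulComplex G a).d (k + 1) k = koszulD G a k :=
  ChainComplex.of_d (koszulX G a) (koszulD G a) k

/-- Functoriality of the Koszul complex. -/
noncomputable def koszulMap (φ : G ⟶ H) : koszulComplex G a ⟶ koszulComplex H a :=
  ChainComplex.ofHom (koszulXMap a φ) fun k => by
    rw [koszulComplex_d, koszulComplex_d]
    exact koszulXMap_comm a φ k

end KoszulMap

end KoszulFunctor

/-! ### Acyclicity of the Koszul complex of a free functor -/

section KoszulFree

theorem koszulSign_mul_self {J : Type v} [PartialOrder J] {a : J} [LinearOrder (Parent a)] (S : Finset (Parent a)) (s : Parent a) :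
    koszulSign S s * koszulSign S s = 1 := by
  rw [koszulSign, ← mul_pow]
  simp

variable {K : Type u} [Field K] {J : Type v} [PartialOrder J] [Finite J]

theorem koszulDZero_sumι {G : J ⥤ ModuleCat.{w} K} {a : J} (S : KoszulIdx a 1) (y : Below S.1)
    (v : G.obj y.1) : (koszulDZero G a).hom (sumι G S (colimι G y v)) =
      res G (Below.le S.nonempty y) v := by
  rw [koszulDZero, sumι_desc, colimι_desc]

theorem koszulDSucc_sumι {G : J ⥤ ModuleCat.{w} K} {a : J} [LinearOrder (Parent a)] {k : ℕ}
    (S : KoszulIdx a (k + 1)) (y : Below S.1) (v : G.obj y.1) :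
    (koszulDSucc G a k).hom (sumι G S (colimι G y v)) = ∑ s : {s // s ∈ S.1}, koszulSign S.1 s.1 •
      sumι G (S.erase s.1 s.2) (colimι G (⟨y.1, fun t ht => y.2 t (Finset.mem_of_mem_erase ht)⟩ :
        Below (S.erase s.1 s.2).1) v) := by
  rw [koszulDSucc, sumι_desc]
  simp only [ModuleCat.hom_sum, LinearMap.coe_sum, Finset.sum_apply]
  refine Finset.sum_congr rfl fun s _ => ?_
  rw [ModuleCat.hom_zsmul, LinearMap.smul_apply, ModuleCat.hom_comp, LinearMap.comp_apply,
    colimι_map]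
  rfl

theorem exists_parent_of_lt {x a : J} (h : x < a) : ∃ p : Parent a, x ≤ p.elt := by
  obtain ⟨y, hy, hmax⟩ := (Set.toFinite {y | x ≤ y ∧ y < a}).exists_maximal ⟨x, le_rfl, h⟩
  exact ⟨⟨y, hy.2, fun z hyz hza => absurd (hmax ⟨hy.1.trans hyz.le, hza⟩ hyz.le)
    (not_le_of_gt hyz)⟩, hy.1⟩

namespace FreeBasis

variable {P : J ⥤ ModuleCat.{w} K} {κ : Type*} {g : κ → J} (B : FreeBasis P g) {a : J}

/-- Independence can be tested after mapping to `P(a)`, where these generators become distinct basis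
elements. -/
theorem linearIndependent_colimι (B : FreeBasis P g) {S : Finset (Parent a)} (hS : S.Nonempty) :
    LinearIndependent K fun k : {k // ∀ s ∈ S, g k ≤ s.elt} =>
      colimι P (⟨g k.1, k.2⟩ : Below S) (B.gen k.1) := by
  apply LinearIndependent.of_comp (belowColimDesc P hS).hom
  have : ((belowColimDesc P hS).hom ∘ fun k : {k // ∀ s ∈ S, g k ≤ s.elt} =>
      colimι P (⟨g k.1, k.2⟩ : Below S) (B.gen k.1)) =
      (B.b a) ∘ fun k => ⟨k.1, Below.le hS ⟨g k.1, k.2⟩⟩ := by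
    funext k
    rw [Function.comp_apply, colimι_desc, B.res_gen]
    rfl
  rw [this]
  exact (B.b a).linearIndependent.comp _ fun k l h => Subtype.ext (by simpa using h)

theorem belowColim_eq_top_of_gen {S : Finset (Parent a)} {N : Submodule K (belowColim P S)}
    (h : ∀ k (hk : ∀ s ∈ S, g k ≤ s.elt), colimι P (⟨g k, hk⟩ : Below S) (B.gen k) ∈ N) :
    N = ⊤ := by
  refine belowColim_eq_top fun y v => ?_
  rw [← (B.b y.1).linearCombination_repr v, Finsupp.linearCombination_apply, Finsupp.sum, map_sum]
  refine Submodule.sum_mem _ fun k _ => ?_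
  rw [map_smul, ← B.res_gen k.1 k.2]
  refine Submodule.smul_mem _ _ ?_
  have hk : ∀ s ∈ S, g k.1 ≤ s.elt := fun s hs => k.2.trans (y.2 s hs)
  rw [colimι_res (y := ⟨g k.1, hk⟩) (y' := y) k.2]
  exact h k.1 hk

/-- The basis of the colimit of a free functor. -/
noncomputable def colimBasis {S : Finset (Parent a)} (hS : S.Nonempty) :
    Module.Basis {k // ∀ s ∈ S, g k ≤ s.elt} K (belowColim P S) :=
  Module.Basis.mk (B.linearIndependent_colimι hS) (by
    rw [top_le_iff]
    exact B.belowColim_eq_top_of_gen fun k hk => Submodule.subset_span ⟨⟨k, hk⟩, rfl⟩)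

theorem colimBasis_apply {S : Finset (Parent a)} (hS : S.Nonempty)
    (k : {k // ∀ s ∈ S, g k ≤ s.elt}) :
    B.colimBasis hS k = colimι P (⟨g k.1, k.2⟩ : Below S) (B.gen k.1) :=
  Module.Basis.mk_apply ..

open Classical in
variable (a) in
/-- The standard generators of the Koszul complex of a free functor. -/
noncomputable def sym : ∀ (n : ℕ) (_ : Finset (Parent a)) (_ : κ), koszulX P a n
  | 0, _, k => if h : g k ≤ a then B.b a ⟨k, h⟩ else 0
  | n + 1, T, k => if h : T.card = n + 1 ∧ ∀ s ∈ T, g k ≤ s.elt then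
      sumι P (⟨T, h.1, g k, h.2⟩ : KoszulIdx a (n + 1))
        (colimι P (⟨g k, h.2⟩ : Below T) (B.gen k)) else 0

theorem sym_zero {T : Finset (Parent a)} {k : κ} (h : g k ≤ a) :
    B.sym a 0 T k = B.b a ⟨k, h⟩ :=
  dif_pos h

theorem sym_succ {n : ℕ} {T : Finset (Parent a)} {k : κ} (h1 : T.card = n + 1)
    (h2 : ∀ s ∈ T, g k ≤ s.elt) : B.sym a (n + 1) T k =
      sumι P (⟨T, h1, g k, h2⟩ : KoszulIdx a (n + 1))
        (colimι P (⟨g k, h2⟩ : Below T) (B.gen k)) :=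
  dif_pos ⟨h1, h2⟩

theorem koszulX_eq_top {n : ℕ} {N : Submodule K (koszulX P a (n + 1))}
    (h : ∀ T k, T.card = n + 1 → (∀ s ∈ T, g k ≤ s.elt) → B.sym a (n + 1) T k ∈ N) : N = ⊤ := by
  refine koszulSum_eq_top (N := N) fun S v => ?_
  have : N.comap (sumι P S) = ⊤ := B.belowColim_eq_top_of_gen fun k hk => by
    have h1 := h S.1 k S.2.1 hk
    rw [B.sym_succ S.2.1 hk] at h1
    exact h1
  have h2 : v ∈ N.comap (sumι P S) := by
    rw [this]
    trivial
  exact h2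

variable [LinearOrder (Parent a)]

theorem koszulD_sym (n : ℕ) {T : Finset (Parent a)} {k : κ} (h1 : T.card = n + 1)
    (h2 : ∀ s ∈ T, g k ≤ s.elt) : (koszulD P a n).hom (B.sym a (n + 1) T k) =
      ∑ s ∈ T, koszulSign T s • B.sym a n (T.erase s) k := by
  rw [B.sym_succ h1 h2]
  cases n with
  | zero =>
    obtain ⟨s, rfl⟩ := Finset.card_eq_one.1 h1
    refine (koszulDZero_sumι _ _ _).trans ?_
    have hk : g k ≤ a := (h2 s (by simp)).trans s.cov.le
    have : koszulSign {s} s = 1 := by simp [koszulSign, Finset.filter_singleton]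
    rw [Finset.sum_singleton, this, one_zsmul]
    exact (B.res_gen k hk).trans (B.sym_zero hk).symm
  | succ n =>
    refine (koszulDSucc_sumι _ _ _).trans ?_
    rw [← Finset.sum_coe_sort T]
    refine Finset.sum_congr rfl fun s _ => ?_
    congr 1
    exact (B.sym_succ ((KoszulIdx.erase (⟨T, h1, g k, h2⟩ : KoszulIdx a (n + 2)) s.1 s.2).2.1)
      fun t ht => h2 t (Finset.mem_of_mem_erase ht)).symm

/-- The values of the contracting homotopy on the standard generators. -/
noncomputable def htpyVal (p : κ → Parent a) (n : ℕ) (T : Finset (Parent a)) (k : κ) :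
    koszulX P a (n + 1) :=
  if p k ∈ T then 0 else koszulSign (insert (p k) T) (p k) • B.sym a (n + 1) (insert (p k) T) k

/-- The contracting homotopy of the Koszul complex of a free functor. -/
noncomputable def htpy (p : κ → Parent a) : ∀ n : ℕ, koszulX P a n →ₗ[K] koszulX P a (n + 1)
  | 0 => (B.b a).constr K fun k => B.htpyVal p 0 ∅ k
  | n + 1 => (koszulSumDesc P a fun S => ModuleCat.ofHom ((B.colimBasis S.nonempty).constr K
      fun k => B.htpyVal p (n + 1) S.1 k.1) : koszulSum P a (n + 1) ⟶ koszulX P a (n + 2)).hom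

theorem htpy_sym (p : κ → Parent a) (n : ℕ) {T : Finset (Parent a)} {k : κ} (h0 : g k ≤ a)
    (h1 : T.card = n) (h2 : ∀ s ∈ T, g k ≤ s.elt) :
    B.htpy p n (B.sym a n T k) = B.htpyVal p n T k := by
  cases n with
  | zero =>
    obtain rfl := Finset.card_eq_zero.1 h1
    rw [B.sym_zero h0]
    exact (B.b a).constr_basis K _ _
  | succ n =>
    rw [B.sym_succ h1 h2]
    refine (sumι_desc _ _ _).trans ?_
    have hT : T.Nonempty := KoszulIdx.nonempty (⟨T, h1, g k, h2⟩ : KoszulIdx a (n + 1))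
    change ((B.colimBasis hT).constr K fun k => B.htpyVal p (n + 1) T k.1)
      (colimι P (⟨g k, h2⟩ : Below T) (B.gen k)) = _
    rw [← B.colimBasis_apply hT ⟨k, h2⟩]
    exact (B.colimBasis hT).constr_basis K _ _

/-- For a fixed generator `k` below `a`, the sets of parents above it form a full simplex, and
inserting the vertex `p k` contracts it. The identity is checked on the standard generators. -/
theorem htpy_identity (p : κ → Parent a) (hp : ∀ k, g k < a → g k ≤ (p k).elt) (n : ℕ)
    (z : koszulX P a (n + 1)) :
    (koszulD P a (n + 1)).hom (B.htpy p (n + 1) z) + B.htpy p n ((koszulD P a n).hom z) = z := by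
  let L : koszulX P a (n + 1) →ₗ[K] koszulX P a (n + 1) :=
    (koszulD P a (n + 1)).hom ∘ₗ B.htpy p (n + 1) + B.htpy p n ∘ₗ (koszulD P a n).hom
  suffices h : LinearMap.eqLocus L LinearMap.id = ⊤ by
    have : z ∈ LinearMap.eqLocus L LinearMap.id := by
      rw [h]
      trivial
    exact this
  refine B.koszulX_eq_top fun S k h1 h2 => ?_
  change (koszulD P a (n + 1)).hom (B.htpy p (n + 1) (B.sym a (n + 1) S k)) +
    B.htpy p n ((koszulD P a n).hom (B.sym a (n + 1) S k)) = B.sym a (n + 1) S k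
  obtain ⟨s₀, hs₀⟩ : S.Nonempty := Finset.card_pos.1 (by omega)
  have hlt : g k < a := (h2 s₀ hs₀).trans_lt s₀.cov.lt
  have hpk := hp k hlt
  have hcard : ∀ s ∈ S, (S.erase s).card = n := fun s hs => by
    rw [Finset.card_erase_of_mem hs, h1]
    rfl
  rw [B.koszulD_sym n h1 h2, B.htpy_sym p (n + 1) hlt.le h1 h2, map_sum]
  have h3 : ∀ s ∈ S, B.htpy p n (koszulSign S s • B.sym a n (S.erase s) k) =
      koszulSign S s • B.htpyVal p n (S.erase s) k := fun s hs => by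
    rw [map_zsmul, B.htpy_sym p n hlt.le (hcard s hs)
      fun t ht => h2 t (Finset.mem_of_mem_erase ht)]
  rw [Finset.sum_congr rfl h3]
  by_cases hpS : p k ∈ S
  -- If `p k` is already a vertex, only the face opposite to it survives the homotopy, and inserting
  -- `p k` restores `S`.
  · rw [htpyVal, if_pos hpS, map_zero, zero_add, Finset.sum_eq_single (p k)]
    · rw [htpyVal, if_neg (Finset.notMem_erase _ _), Finset.insert_erase hpS, smul_smul,
        koszulSign_mul_self, one_smul]
    · intro s _ hs
      rw [htpyVal, if_pos (Finset.mem_erase.2 ⟨hs.symm, hpS⟩), smul_zero]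
    · exact fun h => absurd hpS h
  -- Otherwise the face of `U` opposite to `p k` is `S` itself, and the other faces cancel against
  -- the homotopy applied to the boundary, by the anticommutation of signs.
  · set U := insert (p k) S with hU
    have hpU : p k ∈ U := Finset.mem_insert_self _ _
    have hUS : U.erase (p k) = S := Finset.erase_insert hpS
    have h4 : ∀ s ∈ S, koszulSign S s • B.htpyVal p n (S.erase s) k =
        -(koszulSign U (p k) • koszulSign U s • B.sym a (n + 1) (U.erase s) k) := fun s hs => by
      have hsp : s ≠ p k := fun h => hpS (h ▸ hs)
      have h5 : insert (p k) (S.erase s) = U.erase s := by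
        rw [hU, Finset.erase_insert_of_ne hsp.symm]
      rw [htpyVal, if_neg (fun h => hpS (Finset.mem_of_mem_erase h)), h5, smul_smul, smul_smul,
        ← neg_smul]
      congr 1
      have h6 := koszulSign_swap hpU (Finset.mem_insert_of_mem hs : s ∈ U) hsp.symm
      rw [hUS] at h6
      have h7 := koszulSign_mul_self U (p k)
      have h8 := koszulSign_mul_self (U.erase s) (p k)
      linear_combination (koszulSign (U.erase s) (p k) * koszulSign U (p k)) * h6 -
        (koszulSign S s * koszulSign (U.erase s) (p k)) * h7 -
        (koszulSign U (p k) * koszulSign U s) * h8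
    rw [Finset.sum_congr rfl h4, htpyVal, if_neg hpS, ← hU, map_zsmul, B.koszulD_sym (n + 1)
      ((Finset.card_insert_of_notMem hpS).trans (by rw [h1]))
      (fun s hs => (Finset.mem_insert.1 hs).elim (fun h => h ▸ hpk) (h2 s)),
      Finset.sum_neg_distrib, ← Finset.smul_sum]
    nth_rewrite 2 [hU]
    rw [Finset.sum_insert hpS, hUS, smul_add, smul_smul, koszulSign_mul_self, one_smul]
    abel

include B in
theorem koszul_exact (n : ℕ) (z : koszulX P a (n + 1)) (hz : (koszulD P a n).hom z = 0) :
    ∃ y, (koszulD P a (n + 1)).hom y = z := by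
  -- Without parents the complex is zero in positive degrees. Otherwise `p₀` serves as a dummy
  -- choice for generators not below `a`.
  rcases isEmpty_or_nonempty (Parent a) with hE | ⟨⟨p₀⟩⟩
  · have : (⊥ : Submodule K (koszulX P a (n + 1))) = ⊤ := B.koszulX_eq_top fun T k hT _ => by
      obtain ⟨s, _⟩ : T.Nonempty := Finset.card_pos.1 (by omega)
      exact isEmptyElim s
    have hz0 : z ∈ (⊥ : Submodule K (koszulX P a (n + 1))) := by
      rw [this]
      trivial
    exact ⟨0, by rw [map_zero, (Submodule.mem_bot K).1 hz0]⟩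
  · have : ∀ k, ∃ p : Parent a, g k < a → g k ≤ p.elt := fun k => by
      by_cases h : g k < a
      · exact (exists_parent_of_lt h).imp fun p hp _ => hp
      · exact ⟨p₀, fun h' => absurd h' h⟩
    choose p hp using this
    have h := B.htpy_identity p hp n z
    rw [hz, map_zero, add_zero] at h
    exact ⟨_, h⟩

end FreeBasis

end KoszulFree

/-! ### Koszul homology in degree zero and dimension shifting -/

section Homology

variable {K : Type u} [Field K] {J : Type v} [PartialOrder J]

theorem map_rad {P F : J ⥤ ModuleCat.{w} K} (π : P ⟶ F)
    (hπ : ∀ x, Function.Surjective (appL π x)) (x : J) :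
    (rad P x).map (appL π x) = rad F x := by
  apply le_antisymm
  · rw [Submodule.map_le_iff_le_comap]
    refine rad_le fun y hy v => ?_
    rw [Submodule.mem_comap, appL_res]
    exact res_mem_rad F hy _
  · refine rad_le fun y hy v => ?_
    obtain ⟨u, rfl⟩ := hπ y v
    exact ⟨res P hy.le u, res_mem_rad P hy u, appL_res π hy.le u⟩

variable [Finite J]

/-- In a finite poset every element below `a` lies below a parent of `a`, so the parents generate
the whole radical. -/
theorem range_koszulDZero (G : J ⥤ ModuleCat.{w} K) (a : J) :
    LinearMap.range (koszulDZero G a).hom = rad G a := by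
  apply le_antisymm
  · rw [LinearMap.range_eq_map, Submodule.map_le_iff_le_comap]
    refine (koszulSum_eq_top fun S => ?_).ge
    suffices h : ((rad G a).comap (koszulDZero G a).hom).comap (sumι G S) = ⊤ by
      intro v
      have : v ∈ ((rad G a).comap (koszulDZero G a).hom).comap (sumι G S) := by
        rw [h]
        trivial
      exact this
    refine belowColim_eq_top fun y v => ?_
    rw [Submodule.mem_comap, Submodule.mem_comap, koszulDZero_sumι]
    obtain ⟨s, hs⟩ := S.nonempty
    exact res_mem_rad G ((y.2 s hs).trans_lt s.cov.lt) v
  · refine rad_le fun y hy v => ?_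
    obtain ⟨p, hp⟩ := exists_parent_of_lt hy
    have hS : ∀ s ∈ ({p} : Finset (Parent a)), y ≤ s.elt := by simpa using hp
    exact ⟨_, koszulDZero_sumι (⟨{p}, by simp, y, hS⟩ : KoszulIdx a 1) ⟨y, hS⟩ v⟩

/-- The cycle condition ranges over `j` with `j + 1 = i`, so that it is void in degree zero. -/
theorem homologyMap_eq_zero {C D : ChainComplex (ModuleCat.{w} K) ℕ} (φ : C ⟶ D) (i : ℕ)
    (h : ∀ z : C.X i, (∀ j, j + 1 = i → (C.d i j).hom z = 0) →
      ∃ y, (D.d (i + 1) i).hom y = (φ.f i).hom z) :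
    HomologicalComplex.homologyMap φ i = 0 := by
  rw [← cancel_epi (C.homologyπ i), HomologicalComplex.homologyπ_naturality, comp_zero]
  ext c
  obtain ⟨y, hy⟩ := h ((C.iCycles i).hom c) fun j _ => by
    rw [← LinearMap.comp_apply, ← ModuleCat.hom_comp, C.iCycles_d]
    rfl
  have h1 : (HomologicalComplex.cyclesMap φ i).hom c = (D.toCycles (i + 1) i).hom y := by
    apply (ModuleCat.mono_iff_injective (D.iCycles i)).1 inferInstance
    have e1 := congrArg (fun f : C.cycles i ⟶ D.X i => f.hom c)
      (HomologicalComplex.cyclesMap_i φ i)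
    have e2 := congrArg (fun f : D.X (i + 1) ⟶ D.X i => f.hom y) (D.toCycles_i (i + 1) i)
    exact e1.trans (hy.symm.trans e2.symm)
  have e3 := congrArg (fun f : D.X (i + 1) ⟶ D.homology i => f.hom y)
    (D.toCycles_comp_homologyπ (i + 1) i)
  exact (congrArg (D.homologyπ i).hom h1).trans e3

variable {a : J} [LinearOrder (Parent a)]

theorem FreeBasis.isZero_homology {P : J ⥤ ModuleCat.{w} K} {κ : Type*} {g : κ → J}
    (B : FreeBasis P g) (i : ℕ) : IsZero ((koszulComplex P a).homology (i + 1)) := by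
  apply HomologicalComplex.ExactAt.isZero_homology
  rw [HomologicalComplex.exactAt_iff' _ (i + 2) (i + 1) i (by simp) (by simp),
    ShortComplex.moduleCat_exact_iff]
  intro z hz
  have hz' : ((koszulComplex P a).d (i + 1) i).hom z = 0 := hz
  rw [koszulComplex_d] at hz'
  obtain ⟨y, hy⟩ := B.koszul_exact i z hz'
  exact ⟨y, (congrArg (fun f : koszulX P a (i + 2) ⟶ koszulX P a (i + 1) => f.hom y)
    (koszulComplex_d a P (i + 1))).trans hy⟩

/-- The zeroth homology of the Koszul complex is the top of a minimal cover. -/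
theorem nonempty_iso_homology_zero {P F : J ⥤ ModuleCat.{w} K} {κ : Type*} {g : κ → J}
    (B : FreeBasis P g) {W : ModuleCat.{w} K} (bw : Module.Basis {k // g k = a} K W) (π : P ⟶ F)
    (hπ : ∀ x, Function.Surjective (appL π x)) (hrad : KerLeRad π) :
    Nonempty (W ≅ (koszulComplex F a).homology 0) := by
  let C := koszulComplex F a
  let q : F.obj a →ₗ[K] C.opcycles 0 := (C.pOpcycles 0).hom
  have hq : Function.Surjective q := (ModuleCat.epi_iff_surjective (C.pOpcycles 0)).1 inferInstance
  have hker : LinearMap.ker q = rad F a := by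
    rw [← range_koszulDZero]
    have hex : (ShortComplex.mk (C.d 1 0) (C.pOpcycles 0) (by simp)).Exact :=
      ShortComplex.exact_of_g_is_cokernel _ (C.opcyclesIsCokernel 1 0 (by simp))
    have h1 := hex.moduleCat_range_eq_ker
    have h2 : C.d 1 0 = koszulDZero F a := koszulComplex_d a F 0
    exact h1.symm.trans (congrArg (fun f : koszulSum F a 1 ⟶ F.obj a => LinearMap.range f.hom) h2)
  -- The radical of `F` is the image of that of `P`, and its preimage is no larger since the kernel
  -- of `π` is in the radical.
  have hker' : LinearMap.ker (q ∘ₗ appL π a) = LinearMap.ker (B.top bw) := by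
    rw [LinearMap.ker_comp, hker, B.ker_top, ← map_rad π hπ, Submodule.comap_map_eq,
      sup_eq_left]
    exact hrad a
  let e : W ≃ₗ[K] C.opcycles 0 :=
    ((B.top bw).quotKerEquivOfSurjective (B.top_surjective bw)).symm ≪≫ₗ
      Submodule.quotEquivOfEq _ _ hker'.symm ≪≫ₗ
      (q ∘ₗ appL π a).quotKerEquivOfSurjective (hq.comp (hπ a))
  exact ⟨e.toModuleIso ≪≫ (ChainComplex.isoHomologyι₀ C).symm⟩

/-- Dimension shifting for the homology of Koszul complexes. -/
theorem nonempty_iso_homology_succ {Z P F : J ⥤ ModuleCat.{w} K} {ι : Z ⟶ P} {π : P ⟶ F}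
    {κ : Type*} {g : κ → J} (B : FreeBasis P g) (hS : IsSES ι π) (hrad : KerLeRad π) (i : ℕ)
    (hinj : ∀ k ≤ i, Function.Injective (koszulXMap a ι k).hom) :
    Nonempty ((koszulComplex Z a).homology i ≅ (koszulComplex F a).homology (i + 1)) := by
  let f := koszulMap a ι
  let p := koszulMap a π
  have hepi : Epi p := by
    have : ∀ k, Epi (p.f k) := fun k =>
      (ModuleCat.epi_iff_surjective _).2 (hS.koszulXMap_surjective k)
    exact HomologicalComplex.epi_of_epi_f p this
  have hfp : f ≫ p = 0 := by
    ext k z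
    obtain _ | k := k
    · exact (hS.exact a _).2 ⟨z, rfl⟩
    · refine LinearMap.congr_fun (f := (koszulXMap a π (k + 1)).hom ∘ₗ (koszulXMap a ι (k + 1)).hom)
        (g := 0) (LinearMap.ker_eq_top.1 (koszulSum_eq_top fun S v => ?_)) z
      change (koszulSumNat π (k + 1)).hom ((koszulSumNat ι (k + 1)).hom (sumι Z S v)) = 0
      rw [sumι_nat, sumι_nat]
      suffices h : LinearMap.ker ((belowColimNat π S.1).hom ∘ₗ (belowColimNat ι S.1).hom) = ⊤ by
        have := LinearMap.congr_fun (LinearMap.ker_eq_top.1 h) v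
        exact (congrArg _ this).trans (map_zero _)
      refine belowColim_eq_top fun y v => ?_
      rw [LinearMap.mem_ker, LinearMap.comp_apply, colimι_nat, colimι_nat,
        (hS.exact y.1 _).2 ⟨v, rfl⟩, map_zero]
  -- The kernel of `p` replaces the Koszul complex of `Z`, whose map to that of `P` need not be
  -- injective above degree `i`.
  let S : ShortComplex (ChainComplex (ModuleCat.{w} K) ℕ) :=
    ShortComplex.mk (kernel.ι p) p (kernel.condition p)
  have hSS : S.ShortExact :=
    { exact := ShortComplex.exact_kernel p
      mono_f := inferInstanceAs (Mono (kernel.ι p))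
      epi_g := hepi }
  have hdeg := fun k => hSS.map_of_exact (HomologicalComplex.eval (ModuleCat.{w} K) _ k)
  have hmono : ∀ k, Function.Injective ((kernel.ι p).f k).hom := fun k =>
    (ModuleCat.mono_iff_injective _).1 (hdeg k).mono_f
  let j : koszulComplex Z a ⟶ kernel p := kernel.lift p f hfp
  have hj : ∀ k z, ((kernel.ι p).f k).hom ((j.f k).hom z) = (koszulXMap a ι k).hom z := fun k z =>
    congrArg (fun φ : koszulComplex Z a ⟶ koszulComplex P a => (φ.f k).hom z)
      (kernel.lift_ι p f hfp)
  have hjs : ∀ k, Function.Surjective (j.f k).hom := fun k t => by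
    obtain ⟨u, hu⟩ := hS.koszulXMap_exact k (((kernel.ι p).f k).hom t)
      (congrArg (fun φ : kernel p ⟶ koszulComplex F a => (φ.f k).hom t) (kernel.condition p))
    exact ⟨u, hmono k ((hj k u).trans hu)⟩
  have hji : ∀ k ≤ i, Function.Injective (j.f k).hom := fun k hk z z' h => by
    apply hinj k hk
    rw [← hj, ← hj, h]
  -- Surjective in degree `i + 1`, bijective in degree `i` and injective one degree below is enough
  -- for an isomorphism on `H_i`.
  have hjq : QuasiIsoAt j i := by
    rw [quasiIsoAt_iff]
    have h1 : Epi (((HomologicalComplex.shortComplexFunctor (ModuleCat.{w} K) _ i).map j).τ₁) :=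
      (ModuleCat.epi_iff_surjective _).2 (hjs _)
    have h2 : IsIso (((HomologicalComplex.shortComplexFunctor (ModuleCat.{w} K) _ i).map j).τ₂) :=
      (ConcreteCategory.isIso_iff_bijective _).2 ⟨hji i le_rfl, hjs i⟩
    have h3 : Mono (((HomologicalComplex.shortComplexFunctor (ModuleCat.{w} K) _ i).map j).τ₃) :=
      (ModuleCat.mono_iff_injective _).2 (hji _ (by cases i <;> simp))
    exact ShortComplex.quasiIso_of_epi_of_isIso_of_mono _
  -- For `i = 0` this is minimality: `Z` lands in the radical, which consists of boundaries. For `i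
  -- > 0` it is the acyclicity for `P`.
  have hf0 : HomologicalComplex.homologyMap f i = 0 := by
    refine homologyMap_eq_zero f i fun z hz => ?_
    rw [koszulComplex_d]
    cases i with
    | zero =>
      have h1 : appL ι a z ∈ rad P a := hrad a _ ((hS.exact a _).2 ⟨z, rfl⟩)
      rw [← range_koszulDZero] at h1
      exact h1
    | succ i =>
      have h1 := hz i rfl
      rw [koszulComplex_d] at h1
      refine B.koszul_exact i _ ?_
      have h2 := congrArg (fun φ : koszulX Z a (i + 1) ⟶ koszulX P a i => φ.hom z)
        (koszulXMap_comm a ι i)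
      exact h2.trans ((congrArg (koszulXMap a ι i).hom h1).trans (map_zero _))
  have hk0 : HomologicalComplex.homologyMap S.f i = 0 := by
    rw [← cancel_epi (HomologicalComplex.homologyMap j i), comp_zero,
      ← HomologicalComplex.homologyMap_comp]
    rw [← hf0]
    congr 1
    exact kernel.lift_ι p f hfp
  have hrel : (ComplexShape.down ℕ).Rel (i + 1) i := by simp
  -- In the long exact sequence, the vanishing of `H_{i+1}` for `P` gives injectivity of `δ`, and
  -- the zero map into `H_i` for `P` gives surjectivity.
  have hδm : Mono (hSS.δ (i + 1) i hrel) := hSS.mono_δ _ _ _ (B.isZero_homology i)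
  have hδe : Epi (hSS.δ (i + 1) i hrel) := (hSS.homology_exact₁ (i + 1) i hrel).epi_f hk0
  have : IsIso (hSS.δ (i + 1) i hrel) := isIso_of_mono_of_epi _
  exact ⟨isoOfQuasiIsoAt j i ≪≫ (asIso (hSS.δ (i + 1) i hrel)).symm⟩

/-- `F` starts a minimal free resolution `P_i → ⋯ → P_0 → F` and `W` is the top of `P_i` at `a`. -/
def MinPres (a : J) (W : ModuleCat.{w} K) : ℕ → (J ⥤ ModuleCat.{w} K) → Prop
  | 0, F => ∃ (P : J ⥤ ModuleCat.{w} K) (π : P ⟶ F) (m : ℕ) (g : Fin m → J),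
      Nonempty (FreeBasis P g) ∧ Nonempty (Module.Basis {k // g k = a} K W) ∧
        (∀ x, Function.Surjective (appL π x)) ∧ KerLeRad π
  | i + 1, F => ∃ (Z P : J ⥤ ModuleCat.{w} K) (ι : Z ⟶ P) (π : P ⟶ F) (m : ℕ) (g : Fin m → J),
      Nonempty (FreeBasis P g) ∧ IsSES ι π ∧ KerLeRad π ∧ MinPres a W i Z

/-- Dimension shifting `i` times reduces to `H_0` of the last syzygy. The shifts use left exactness
only in degrees `k < i`, and degree zero is evaluation at `a`, hence the restriction to non-empty
`S`. -/
theorem MinPres.nonempty_iso {W : ModuleCat.{w} K} {i : ℕ} {F : J ⥤ ModuleCat.{w} K}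
    (h : MinPres a W i F) (htop : ∀ k < i, ∀ S : KoszulIdx a k, S.1.Nonempty →
      ∃ y : Below S.1, ∀ y', y' ≤ y) :
    Nonempty (W ≅ (koszulComplex F a).homology i) := by
  induction i generalizing F with
  | zero =>
    obtain ⟨P, π, m, g, ⟨B⟩, ⟨bw⟩, hπ, hrad⟩ := h
    exact nonempty_iso_homology_zero B bw π hπ hrad
  | succ i ih =>
    obtain ⟨Z, P, ι, π, m, g, ⟨B⟩, hS, hrad, hZ⟩ := h
    obtain ⟨e⟩ := ih hZ fun k hk => htop k (by omega)
    obtain ⟨e'⟩ := nonempty_iso_homology_succ B hS hrad i fun k hk =>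
      hS.koszulXMap_injective k (htop k (by omega))
    exact ⟨e ≪≫ e'⟩

end Homology

/-! ### Restricting minimal resolutions to a subposet -/

section Restriction

variable {K : Type u} [Field K] {J : Type v} [PartialOrder J]

theorem IsSES.whiskerLeft {J' : Type v} [PartialOrder J'] {Z P F : J ⥤ ModuleCat.{w} K}
    {ι : Z ⟶ P} {π : P ⟶ F} (h : IsSES ι π) (α : J' ⥤ J) :
    IsSES (Functor.whiskerLeft α ι) (Functor.whiskerLeft α π) :=
  ⟨fun x => h.inj (α.obj x), fun x => h.exact (α.obj x), fun x => h.surj (α.obj x)⟩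

/-- A subposet has fewer elements below `x`, but membership in the radical only involves the
generators of degree exactly `x`, and all generator degrees lie in `G`. -/
theorem FreeBasis.kerLeRad_restrict {P F : J ⥤ ModuleCat.{w} K} {κ : Type*} {g : κ → J}
    (B : FreeBasis P g) {G : Set J} (α : G ⥤ J) (hα : ∀ x : G, α.obj x = x.1)
    (hg : ∀ k, g k ∈ G) {π : P ⟶ F} (hπ : KerLeRad π) : KerLeRad (Functor.whiskerLeft α π) := by
  intro x v hv
  rw [(B.restrict α hα hg).mem_rad_iff]
  rintro ⟨k, hk⟩ hkx
  simp only [FreeBasis.restrict, Module.Basis.repr_reindex, Finsupp.mapDomain_equiv_apply]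
  exact B.mem_rad_iff.1 (hπ (α.obj x) v hv) _ ((congrArg Subtype.val hkx).trans (hα x).symm)

namespace Resolution

variable {n : ℕ∞} {F : J ⥤ ModuleCat.{w} K} (P : Resolution n F)

/-- The syzygies of a resolution. -/
noncomputable def syzygy : ℕ → (J ⥤ ModuleCat.{w} K)
  | 0 => F
  | k + 1 => kernel (P.augD k)

/-- The maps onto the syzygies of a resolution. -/
noncomputable def toSyzygy : ∀ k : ℕ, P.complex.X k ⟶ P.syzygy k
  | 0 => P.augD 0
  | k + 1 => P.toKernel k

theorem isSES_toSyzygy : ∀ k : ℕ, (k : ℕ∞) < n → IsSES (kernel.ι (P.augD k)) (P.toSyzygy k)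
  | 0, hk => P.isSES_zero hk
  | k + 1, hk => P.isSES_succ k hk

variable {P}

theorem RadMinimal.kerLeRad_toSyzygy (hP : P.RadMinimal) (k : ℕ) (hk : (k : ℕ∞) < n) :
    KerLeRad (P.toSyzygy k) := fun x v hv =>
  hP k hk x v ((appL_eq_zero_iff_kernel _ _ _).2 (((P.isSES_toSyzygy k hk).exact x v).1 hv))

/-- Exactness is pointwise, so it survives restriction; the support condition keeps freeness and
minimality up to degree `i`. The induction starts at the syzygy `j` with `m` steps left. -/
theorem RadMinimal.minPres (hP : P.RadMinimal) {β : ℕ → J → ModuleCat.{w} K}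
    (hβ : ∀ i : ℕ, (i : ℕ∞) < n → HasBettiDiagram (P.complex.X i) (β i)) {G : Set J} (α : G ⥤ J)
    (hα : ∀ x : G, α.obj x = x.1) {i : ℕ} (hi : (i : ℕ∞) < n) (hG : ∀ j ≤ i, supp (β j) ⊆ G)
    (x : G) : ∀ m j : ℕ, j + m = i → MinPres x (β i x.1) m (α ⋙ P.syzygy j) := by
  have hlt : ∀ j ≤ i, (j : ℕ∞) < n := fun j hj => lt_of_le_of_lt (Nat.cast_le.2 hj) hi
  have hbasis : ∀ j ≤ i, ∃ (m : ℕ) (g : Fin m → J) (_ : ∀ k, g k ∈ G),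
      Nonempty (FreeBasis (P.complex.X j) g) ∧
        ∀ a, Nonempty (Module.Basis {k // g k = a} K (β j a)) := by
    intro j hj
    obtain ⟨m, g, hB, hbw⟩ := (hβ j (hlt j hj)).exists_freeBasis
    refine ⟨m, g, fun k => hG j hj ?_, hB, hbw⟩
    obtain ⟨bw⟩ := hbw (g k)
    exact nontrivial_of_ne _ _ (bw.ne_zero ⟨k, rfl⟩)
  intro m
  induction m with
  | zero =>
    rintro i rfl
    obtain ⟨m, g, hg, ⟨B⟩, hbw⟩ := hbasis i le_rfl
    obtain ⟨bw⟩ := hbw x.1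
    exact ⟨_, Functor.whiskerLeft α (P.toSyzygy i), m, _, ⟨B.restrict α hα hg⟩,
      ⟨bw.reindex (Equiv.subtypeEquivRight fun k => by rw [Subtype.ext_iff])⟩,
      ((P.isSES_toSyzygy i hi).whiskerLeft α).surj,
      B.kerLeRad_restrict α hα hg (hP.kerLeRad_toSyzygy i hi)⟩
  | succ m ih =>
    intro j hj
    have hji : j ≤ i := by omega
    obtain ⟨_, g, hg, ⟨B⟩, -⟩ := hbasis j hji
    exact ⟨_, _, _, Functor.whiskerLeft α (P.toSyzygy j), _, _, ⟨B.restrict α hα hg⟩,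
      (P.isSES_toSyzygy j (hlt j hji)).whiskerLeft α,
      B.kerLeRad_restrict α hα hg (hP.kerLeRad_toSyzygy j (hlt j hji)), ih (j + 1) (by omega)⟩

end Resolution

end Restriction

/-! ### Parents, infima and sups in grids -/

section Grids

variable {I : Type v} [PartialOrder I]

/-- Parents depend only on the element. -/
def Parent.cast {a b : I} (h : b = a) (p : Parent a) : Parent b :=
  ⟨p.elt, h ▸ p.cov⟩

theorem FiniteType.exists_parent (hI : FiniteType I) {b a : I} (h : b < a) :
    ∃ p : Parent a, b ≤ p.elt := by
  obtain ⟨y, hy, hmax⟩ := ((hI a).subset (fun y hy => hy.2.le : {y | b ≤ y ∧ y < a} ⊆ _)).exists_maximal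
    ⟨b, le_rfl, h⟩
  exact ⟨⟨y, hy.2, fun z hyz hza => absurd (hmax ⟨hy.1.trans hyz.le, hza⟩ hyz.le)
    (not_le_of_gt hyz)⟩, hy.1⟩

theorem FiniteType.finite_parent (hI : FiniteType I) (a : I) : Finite (Parent a) := by
  have : Finite (Set.Iic a) := hI a
  exact Finite.of_injective (fun p : Parent a => (⟨p.elt, p.cov.le⟩ : Set.Iic a))
    fun p q h => Parent.ext (congrArg Subtype.val h)

/-- Over one base every parent is independent, and the only parent below it is itself, so the
infimum is a single value. -/
theorem GPoint.le_iff_of_base_eq {A B : GPoint I} (h : B.base = A.base) :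
    A ≤ B ↔ ∀ p : Parent A.base, A.val p ≤ B.val (p.cast h) := by
  obtain ⟨b, g, hg⟩ := B
  dsimp only at h
  subst h
  constructor
  · intro hle p
    have := hle.infi p ⟨parent_not_le p, p, le_rfl⟩
    rwa [iInf_parent] at this
  · intro hle
    exact ⟨le_rfl, fun x _ => Or.inr ⟨parent_not_le x, x, le_rfl⟩, fun x _ => by
      rw [iInf_parent]
      exact hle x⟩

theorem Realisation.le_iff_of_base_eq {A B : Realisation I} (h : B.base = A.base) :
    A ≤ B ↔ ∀ p : Parent A.base, A.val p ≤ B.val (p.cast h) :=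
  GPoint.le_iff_of_base_eq h

/-- The supports of all points above a given one have a common ancestor. -/
theorem Realisation.exists_ancestor (z : Realisation I) : ∃ c : I, c ≤ z.base ∧
    ∀ y : Realisation I, z ≤ y → ∀ p : Parent y.base, y.val p < 0 → c ≤ p.elt := by
  have key : ∀ y : Realisation I, z ≤ y → ∀ p : Parent y.base, y.val p < 0 →
      z.base ≤ p.elt ∨ ∃ q : Parent z.base, z.val q < 0 ∧ q.elt ≤ p.elt := by
    intro y hzy p hp
    rcases GPoint.Rel.consistent hzy p hp with h | h
    · exact Or.inl h
    · have h1 := GPoint.Rel.infi hzy p h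
      obtain ⟨q, hq⟩ := h.2
      have : Nonempty {q : Parent z.base // q.elt ≤ p.elt} := ⟨⟨q, hq⟩⟩
      obtain ⟨q', hq'⟩ := exists_lt_of_ciInf_lt (lt_of_le_of_lt h1 hp)
      exact Or.inr ⟨q'.1, hq', q'.2⟩
  -- If the support of `z` is empty, its recorded ancestor is unrelated to `z`, and the base of `z`
  -- is used instead.
  by_cases hz : ∃ q, z.val q < 0
  · obtain ⟨q, hq⟩ := hz
    obtain ⟨c, hc⟩ := z.ancestor
    have hcz : c ≤ z.base := (hc q hq).trans q.cov.le
    refine ⟨c, hcz, fun y hzy p hp => ?_⟩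
    rcases key y hzy p hp with h | ⟨q', hq', h⟩
    · exact hcz.trans h
    · exact (hc q' hq').trans h
  · refine ⟨z.base, le_rfl, fun y hzy p hp => ?_⟩
    rcases key y hzy p hp with h | ⟨q', hq', -⟩
    · exact h
    · exact absurd ⟨q', hq'⟩ hz

variable (hI : FiniteType I) {d : I} {V : Set ℝ}

include hI in
/-- Parents in a grid of a point whose values can be lowered have the same base. -/
theorem Parent.base_eq (hV : V ⊆ Set.Ioo (-1) 0) {x : grid (Set.Iic d) V} {ε : ℝ}
    (hε : ε ∈ V) (hx : ∀ p, ε < x.1.val p) (s : Parent x) : s.elt.1.base = x.1.base := by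
  classical
  by_contra hne
  have hle : s.elt.1 ≤ x.1 := s.cov.le
  have hlt : s.elt.1.base < x.1.base := lt_of_le_of_ne (GPoint.Rel.base_le hle) hne
  obtain ⟨c, hcs, hc⟩ := s.elt.1.exists_ancestor
  have := hI.finite_parent x.1.base
  -- Lowering `x` to `ε` at the parents above the base of `s` gives a point between `s` and `x`.
  -- These coordinates are dependent, so they impose no inequality on `s`; and there is at least
  -- one, so the point is strictly below `x`.
  let f : Parent x.1.base → ℝ := fun p => if s.elt.1.base ≤ p.elt then ε else x.1.val p
  have hf1 : ∀ p, s.elt.1.base ≤ p.elt → f p = ε := fun p hp => if_pos hp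
  have hf2 : ∀ p, ¬ s.elt.1.base ≤ p.elt → f p = x.1.val p := fun p hp => if_neg hp
  let y : Realisation I :=
    { base := x.1.base
      val := f
      mem := fun p => by
        by_cases hp : s.elt.1.base ≤ p.elt
        · rw [hf1 p hp]
          exact ⟨(hV hε).1.le, (hV hε).2.le⟩
        · rw [hf2 p hp]
          exact x.1.mem p
      neg_one_lt := fun p => by
        by_cases hp : s.elt.1.base ≤ p.elt
        · rw [hf1 p hp]
          exact (hV hε).1
        · rw [hf2 p hp]
          exact x.1.neg_one_lt p
      finite_support := Set.toFinite _
      ancestor := ⟨c, fun p hp => by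
        by_cases hp' : s.elt.1.base ≤ p.elt
        · exact hcs.trans hp'
        · rw [hf2 p hp'] at hp
          exact hc x.1 hle p hp⟩ }
  have hy : y ∈ grid (Set.Iic d) V := by
    refine ⟨x.2.1, fun p hp => ?_⟩
    change f p < 0 at hp
    change f p ∈ V
    by_cases hp' : s.elt.1.base ≤ p.elt
    · rw [hf1 p hp']
      exact hε
    · rw [hf2 p hp'] at hp ⊢
      exact x.2.2 p hp
  have hsy : s.elt.1 ≤ y :=
    ⟨hlt.le, fun p hp => by
      by_cases hp' : s.elt.1.base ≤ p.elt
      · exact Or.inl hp'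
      · change f p < 0 at hp
        rw [hf2 p hp'] at hp
        exact GPoint.Rel.consistent hle p hp, fun p hp => by
      change _ ≤ f p
      rw [hf2 p hp.1]
      exact GPoint.Rel.infi hle p hp⟩
  have hyx : y ≤ x.1 := (Realisation.le_iff_of_base_eq (A := y) (B := x.1) rfl).2 fun p => by
    change f p ≤ x.1.val p
    by_cases hp : s.elt.1.base ≤ p.elt
    · rw [hf1 p hp]
      exact (hx p).le
    · rw [hf2 p hp]
  have hne' : y ≠ x.1 := by
    intro h
    obtain ⟨p, hp⟩ := hI.exists_parent hlt
    have h1 := (Realisation.le_iff_of_base_eq (A := x.1) (B := y) rfl).1 h.ge p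
    change x.1.val p ≤ f p at h1
    rw [hf1 p hp] at h1
    exact absurd (hx p) (not_lt_of_ge h1)
  have hsy' : s.elt < ⟨y, hy⟩ := lt_of_le_of_ne hsy fun h => hne (congrArg (fun z => z.1.base) h)
  exact s.cov.2 hsy' (lt_of_le_of_ne hyx fun h => hne' (congrArg Subtype.val h))

include hI in
/-- A set of parents in a grid with the same base and with an ancestor has an infimum. -/
theorem exists_greatest_below {x : grid (Set.Iic d) V}
    (hb : ∀ s : Parent x, x.1.base = s.elt.1.base) {S : Finset (Parent x)} (hS : S.Nonempty)
    {z : grid (Set.Iic d) V} (hz : ∀ s ∈ S, z ≤ s.elt) : ∃ y : Below S, ∀ y', y' ≤ y := by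
  obtain ⟨c, -, hc⟩ := z.1.exists_ancestor
  have := hI.finite_parent x.1.base
  -- The infimum is the pointwise minimum. Its support is the union of the supports, and only the
  -- ancestor `z` of `S` makes that union have an ancestor in `I`. The minimum is attained at each
  -- `p`, so the conditions for `y` below it follow from those below some `s`.
  let f : Parent x.1.base → ℝ := fun p => S.inf' hS fun s => s.elt.1.val (p.cast (hb s).symm)
  have hf : ∀ p, ∃ s ∈ S, f p = s.elt.1.val (p.cast (hb s).symm) := fun p =>
    Finset.exists_mem_eq_inf' hS _
  let m : Realisation I :=
    { base := x.1.base
      val := f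
      mem := fun p => by
        obtain ⟨s, -, hs⟩ := hf p
        rw [hs]
        exact s.elt.1.mem _
      neg_one_lt := fun p => by
        obtain ⟨s, -, hs⟩ := hf p
        rw [hs]
        exact s.elt.1.neg_one_lt _
      finite_support := Set.toFinite _
      ancestor := ⟨c, fun p hp => by
        obtain ⟨s, hsS, hs⟩ := hf p
        rw [hs] at hp
        exact hc s.elt.1 (hz s hsS) _ hp⟩ }
  have hm : m ∈ grid (Set.Iic d) V := by
    refine ⟨x.2.1, fun p hp => ?_⟩
    obtain ⟨s, -, hs⟩ := hf p
    change f p < 0 at hp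
    change f p ∈ V
    rw [hs] at hp ⊢
    exact s.elt.2.2 _ hp
  have hms : ∀ s ∈ S, (⟨m, hm⟩ : grid (Set.Iic d) V) ≤ s.elt := fun s hs =>
    (Realisation.le_iff_of_base_eq (A := m) (hb s).symm).2 fun p => Finset.inf'_le _ hs
  refine ⟨⟨⟨m, hm⟩, hms⟩, ?_⟩
  rintro ⟨y, hy⟩
  refine (?_ : GPoint.Rel y.1.toGPoint m.toGPoint)
  obtain ⟨s₀, hs₀⟩ := hS
  refine ⟨(GPoint.Rel.base_le (hy s₀ hs₀)).trans (hb s₀).ge, fun p hp => ?_, fun p hp => ?_⟩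
  · obtain ⟨s, hsS, hs⟩ := hf p
    change f p < 0 at hp
    rw [hs] at hp
    exact GPoint.Rel.consistent (hy s hsS) _ hp
  · change _ ≤ f p
    obtain ⟨s, hsS, hs⟩ := hf p
    rw [hs]
    exact GPoint.Rel.infi (hy s hsS) (p.cast (hb s).symm) hp

/-- A point of the realisation is a sup of any two of its parents in a grid with the same base. -/
theorem isSup_pair {x : grid (Set.Iic d) V} {s t : Parent x} (hst : s ≠ t)
    (hs : x.1.base = s.elt.1.base) (ht : x.1.base = t.elt.1.base) :
    IsSup {s.elt.1, t.elt.1} x.1 := by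
  have hsx : s.elt.1 ≤ x.1 := s.cov.le
  have htx : t.elt.1 ≤ x.1 := t.cov.le
  -- The pointwise maximum lies in the grid between both parents and `x`; as the parents differ and
  -- are covered by `x`, it must be `x`.
  let f : Parent x.1.base → ℝ := fun p =>
    max (s.elt.1.val (p.cast hs.symm)) (t.elt.1.val (p.cast ht.symm))
  have hf : ∀ p, f p = s.elt.1.val (p.cast hs.symm) ∨ f p = t.elt.1.val (p.cast ht.symm) :=
    fun p => max_choice _ _
  let m : Realisation I :=
    { base := x.1.base
      val := f
      mem := fun p => by
        rcases hf p with h | h <;> rw [h]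
        exacts [s.elt.1.mem _, t.elt.1.mem _]
      neg_one_lt := fun p => by
        rcases hf p with h | h <;> rw [h]
        exacts [s.elt.1.neg_one_lt _, t.elt.1.neg_one_lt _]
      finite_support := by
        have hinj : Function.Injective
            (fun p => p.cast hs.symm : Parent x.1.base → Parent s.elt.1.base) :=
          fun p q h => by
            have h' := congrArg Parent.elt h
            exact Parent.ext h'
        exact (s.elt.1.finite_support.preimage hinj.injOn).subset fun p (hp : f p < 0) =>
          show s.elt.1.val (p.cast hs.symm) < 0 from lt_of_le_of_lt (le_max_left _ _) hp
      ancestor := by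
        obtain ⟨c, hc⟩ := s.elt.1.ancestor
        exact ⟨c, fun p hp => hc (p.cast hs.symm) (lt_of_le_of_lt (le_max_left _ _) hp)⟩ }
  have hm : m ∈ grid (Set.Iic d) V := by
    refine ⟨x.2.1, fun p hp => ?_⟩
    change f p < 0 at hp
    change f p ∈ V
    rcases hf p with h | h <;> rw [h] at hp ⊢
    exacts [s.elt.2.2 _ hp, t.elt.2.2 _ hp]
  have hsm : s.elt ≤ ⟨m, hm⟩ :=
    (Realisation.le_iff_of_base_eq (A := s.elt.1) (B := m) hs).2 fun p => le_max_left _ _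
  have htm : t.elt ≤ ⟨m, hm⟩ :=
    (Realisation.le_iff_of_base_eq (A := t.elt.1) (B := m) ht).2 fun p => le_max_right _ _
  have hmx : (⟨m, hm⟩ : grid (Set.Iic d) V) ≤ x :=
    (Realisation.le_iff_of_base_eq (A := m) (B := x.1) rfl).2 fun p => max_le
      ((Realisation.le_iff_of_base_eq hs).1 hsx (p.cast hs.symm))
      ((Realisation.le_iff_of_base_eq ht).1 htx (p.cast ht.symm))
  have hmx' : (⟨m, hm⟩ : grid (Set.Iic d) V) = x := by
    by_contra hne
    have h1 : s.elt = ⟨m, hm⟩ := hsm.eq_of_not_lt fun h => s.cov.2 h (lt_of_le_of_ne hmx hne)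
    have h2 : t.elt = ⟨m, hm⟩ := htm.eq_of_not_lt fun h => t.cov.2 h (lt_of_le_of_ne hmx hne)
    exact hst (Parent.ext (h1.trans h2.symm))
  have hmx'' : m = x.1 := congrArg Subtype.val hmx'
  refine ⟨?_, fun y hy hyx => ?_⟩
  · rintro _ (rfl | rfl)
    exacts [hsx, htx]
  · have hsy : s.elt.1 ≤ y := hy (Set.mem_insert _ _)
    have hty : t.elt.1 ≤ y := hy (Set.mem_insert_of_mem _ rfl)
    -- An upper bound `y ≤ x` in the whole realisation has its base squeezed to that of `x`, so the
    -- order is pointwise and `y` dominates the maximum.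
    have hyb : y.base = x.1.base :=
      le_antisymm (GPoint.Rel.base_le hyx) (hs.le.trans (GPoint.Rel.base_le hsy))
    have hmy : m ≤ y := (Realisation.le_iff_of_base_eq (A := m) hyb).2 fun p => max_le
      ((Realisation.le_iff_of_base_eq (hyb.trans hs)).1 hsy (p.cast hs.symm))
      ((Realisation.le_iff_of_base_eq (hyb.trans ht)).1 hty (p.cast ht.symm))
    rwa [hmx''] at hmy

/-- By `isSup_pair` such a set of parents is one of those over which the parental dimension is a
supremum. -/
theorem card_le_parDim {x : grid (Set.Iic d) V} (hb : ∀ s : Parent x, x.1.base = s.elt.1.base)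
    {S : Finset (Parent x)} {z : grid (Set.Iic d) V} (hz : ∀ s ∈ S, z ≤ s.elt) :
    (S.card : ℕ∞) ≤ parDim x.1 := by
  let e : Parent x ↪ Realisation I :=
    ⟨fun s => s.elt.1, fun s t h => Parent.ext (Subtype.ext h)⟩
  have hU : S.map e ∈ parDimSets x.1 := by
    refine ⟨fun u hu => ?_, ⟨z.1, fun u hu => ?_⟩, fun u hu u' hu' huu => ?_⟩
    · obtain ⟨s, -, rfl⟩ := Finset.mem_map.1 hu
      exact s.cov.lt
    · obtain ⟨s, hs, rfl⟩ := Finset.mem_map.1 hu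
      exact hz s hs
    · obtain ⟨s, -, rfl⟩ := Finset.mem_map.1 hu
      obtain ⟨t, -, rfl⟩ := Finset.mem_map.1 hu'
      exact isSup_pair (fun h => huu (congrArg e h)) (hb s) (hb t)
  have h := le_iSup₂ (f := fun (U : Finset (Realisation I)) (_ : U ∈ parDimSets x.1) =>
    (U.card : ℕ∞)) _ hU
  rwa [Finset.card_map] at h

-- Finite type leaves finitely many values, all above `-1`, so there is room below the least of
-- them.
include hI in
theorem Realisation.exists_lt_val (x : Realisation I) :
    ∃ ε ∈ Set.Ioo (-1 : ℝ) 0, ∀ p, ε < x.val p := by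
  have := hI.finite_parent x.base
  obtain ⟨m, hm⟩ : ∃ m, -1 < m ∧ m ≤ 0 ∧ ∀ p, m ≤ x.val p := by
    rcases isEmpty_or_nonempty (Parent x.base) with h | h
    · exact ⟨0, by norm_num, le_rfl, fun p => isEmptyElim p⟩
    · obtain ⟨p, hp⟩ := Finite.exists_min x.val
      exact ⟨x.val p, x.neg_one_lt p, (x.mem p).2, hp⟩
  obtain ⟨ε, h1, h2⟩ := exists_between hm.1
  exact ⟨ε, ⟨h1, h2.trans_le hm.2.1⟩, fun p => h2.trans_le (hm.2.2 p)⟩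

end Grids

/-! ### Betti diagrams as Koszul homology, and vanishing -/

section Main

variable {K : Type u} [Field K] {I : Type v} [PartialOrder I]

theorem isZero_homology_of_isEmpty {J : Type v} [PartialOrder J] [Finite J]
    (G : J ⥤ ModuleCat.{w} K) (a : J) [LinearOrder (Parent a)] (i : ℕ)
    (h : IsEmpty (KoszulIdx a (i + 1))) : IsZero ((koszulComplex G a).homology (i + 1)) := by
  have h0 : IsZero ((koszulComplex G a).X (i + 1)) := by
    change IsZero (koszulSum G a (i + 1))
    rw [IsZero.iff_id_eq_zero]
    exact koszulSum_hom_ext G a fun S => h.elim S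
  apply HomologicalComplex.ExactAt.isZero_homology
  exact ShortComplex.exact_of_isZero_X₂ _ h0

theorem AreBettiDiagrams.minPres {n : ℕ∞} {F : Realisation I ⥤ ModuleCat.{w} K}
    {β : ℕ → Realisation I → ModuleCat.{w} K} (hβ : AreBettiDiagrams n F β) {i : ℕ}
    (hi : (i : ℕ∞) < n) {D : Set I} {V : Set ℝ} (hG : ∀ j ≤ i, supp (β j) ⊆ grid D V)
    (x : grid D V) : MinPres x (β i x.1) i (gridIncl D V ⋙ F) := by
  obtain ⟨P, hP, hβ⟩ := hβ
  exact hP.radMinimal.minPres hβ (gridIncl D V) (fun _ => rfl) hi hG x i 0 (zero_add i)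

theorem betti_iso_of_lt (hI : FiniteType I) {n : ℕ∞} {F : Realisation I ⥤ ModuleCat.{w} K}
    {β : ℕ → Realisation I → ModuleCat.{w} K} (hβ : AreBettiDiagrams n F β) {i : ℕ}
    (hi : (i : ℕ∞) < n) {d : I} {V : Set ℝ} (hV : V.Finite) (hV' : V ⊆ Set.Ioo (-1) 0)
    (hG : ∀ j ≤ i, supp (β j) ⊆ grid (Set.Iic d) V) (x : grid (Set.Iic d) V)
    [LinearOrder (Parent x)] {ε : ℝ} (hε : ε ∈ V) (hx : ∀ p, ε < x.1.val p) :
    Nonempty (β i x.1 ≅ (gridKoszul hI d hV F x).homology i) := by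
  have := grid_finite hI d hV
  refine (hβ.minPres hi hG x).nonempty_iso fun k _ S hS => ?_
  obtain ⟨z, hz⟩ := S.2.2
  exact exists_greatest_below hI (fun s => (s.base_eq hI hV' hε hx).symm) hS hz

/-- The sets of parents in question are non-empty with fewer than two elements, and the part of the
grid below one parent has that parent as its greatest element. -/
theorem betti_iso_of_lt_three (hI : FiniteType I) {n : ℕ∞} {F : Realisation I ⥤ ModuleCat.{w} K}
    {β : ℕ → Realisation I → ModuleCat.{w} K} (hβ : AreBettiDiagrams n F β) {i : ℕ}
    (hi : (i : ℕ∞) < n) {d : I} {V : Set ℝ} (hV : V.Finite)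
    (hG : ∀ j ≤ i, supp (β j) ⊆ grid (Set.Iic d) V) (hi3 : i < 3) (x : grid (Set.Iic d) V)
    [LinearOrder (Parent x)] :
    Nonempty (β i x.1 ≅ (gridKoszul hI d hV F x).homology i) := by
  have := grid_finite hI d hV
  refine (hβ.minPres hi hG x).nonempty_iso fun k hk S hS => ?_
  have hcard := Finset.card_pos.2 hS
  have h1 : S.1.card = 1 := by
    have := S.2.1
    omega
  obtain ⟨s, hs⟩ := Finset.card_eq_one.1 h1
  exact ⟨⟨s.elt, by simp [hs]⟩, fun y => y.2 s (by simp [hs])⟩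

/-- The Betti diagrams do not depend on `V`, so `V` may be enlarged by some `ε` below all values at
`x`. Then `betti_iso_of_lt` applies, and the Koszul term in degree `i` is an empty sum by
`card_le_parDim`. -/
theorem subsingleton_betti (hI : FiniteType I) {n : ℕ∞} {F : Realisation I ⥤ ModuleCat.{w} K}
    {β : ℕ → Realisation I → ModuleCat.{w} K} (hβ : AreBettiDiagrams n F β) {i : ℕ}
    (hi : (i : ℕ∞) < n) {d : I} {V : Set ℝ} (hV : V.Finite) (hV' : V ⊆ Set.Ioo (-1) 0)
    (hG : ∀ j ≤ i, supp (β j) ⊆ grid (Set.Iic d) V) (x : Realisation I)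
    (hx : parDim x < (i : ℕ∞)) : Subsingleton (β i x) := by
  by_contra hne
  obtain ⟨ε, hε, hlt⟩ := x.exists_lt_val hI
  have hGε : ∀ j ≤ i, supp (β j) ⊆ grid (Set.Iic d) (insert ε V) := fun j hj y hy =>
    ⟨(hG j hj hy).1, fun p hp => Or.inr ((hG j hj hy).2 p hp)⟩
  let x' : grid (Set.Iic d) (insert ε V) := ⟨x, hGε i le_rfl (not_subsingleton_iff_nontrivial.1 hne)⟩
  have hVε : insert ε V ⊆ Set.Ioo (-1 : ℝ) 0 := Set.insert_subset hε hV'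
  have := grid_finite hI d (hV.insert ε)
  -- Any linear order will do, since only the vanishing of a term is used.
  let : LinearOrder (Parent x') := IsWellOrder.linearOrder WellOrderingRel
  obtain ⟨e⟩ := betti_iso_of_lt hI hβ hi (hV.insert ε) hVε hGε x' (Set.mem_insert ε V) hlt
  obtain _ | i := i
  · simp at hx
  have hE : IsEmpty (KoszulIdx x' (i + 1)) := ⟨fun S => by
    obtain ⟨z, hz⟩ := S.2.2
    have h := card_le_parDim
      (fun s => (s.base_eq hI hVε (Set.mem_insert ε V) hlt).symm : ∀ s : Parent x', _) hz
    rw [S.2.1] at h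
    exact absurd hx (not_lt_of_ge h)⟩
  exact hne (ModuleCat.isZero_iff_subsingleton.1
    ((isZero_homology_of_isEmpty (gridIncl (Set.Iic d) (insert ε V) ⋙ F) x' i hE).of_iso e))

end Main

theorem mainTheorem4 {K : Type u} [Field K] {I : Type v} [PartialOrder I] (hI : FiniteType I)
    (n : ℕ∞) (F : Realisation I ⥤ ModuleCat.{w} K) (hfin : ∀ x, Module.Finite K (F.obj x))
    (hF : IsResolvable n F) :
    -- the Betti diagrams of `F` exist
    (∃ β : ℕ → Realisation I → ModuleCat.{w} K, AreBettiDiagrams n F β) ∧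
    ∀ β : ℕ → Realisation I → ModuleCat.{w} K, AreBettiDiagrams n F β →
    ∀ i : ℕ, (i : ℕ∞) < n →
    ∀ (d : I) (V : Set ℝ) (hV : V.Finite), V ⊆ Set.Ioo (-1) 0 →
    (∀ j ≤ i, supp (β j) ⊆ grid (Set.Iic d) V) →
      (i < 3 → ∀ (x : grid (Set.Iic d) V) [LinearOrder (Parent x)],
        Nonempty (β i x.1 ≅ (gridKoszul hI d hV F x).homology i)) ∧
      (∀ (x : grid (Set.Iic d) V) [LinearOrder (Parent x)],
        (∃ ε ∈ V, ∀ p, ε < x.1.val p) →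
        Nonempty (β i x.1 ≅ (gridKoszul hI d hV F x).homology i)) ∧
      (∀ x : Realisation I, parDim x < (i : ℕ∞) → Subsingleton (β i x)) := by
  refine ⟨hF.exists_areBettiDiagrams, fun β hβ i hi d V hV hV' hG => ⟨fun hi3 x _ => ?_,
    fun x _ ⟨ε, hε, hx⟩ => ?_, fun x hx => ?_⟩⟩
  · exact betti_iso_of_lt_three hI hβ hi hV hG hi3 x
  · exact betti_iso_of_lt hI hβ hi hV hV' hG x hε hx
  · exact subsingleton_betti hI hβ hi hV hV' hG x hx
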